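/- **Setting.** Let $\boldsymbol{k}=(k_1,\dots,k_n)$ be a graphical sequence of nonnegative integers, i.e. the set $G(\boldsymbol{k})$ of simple graphs on $[n]$ in which every vertex $j$ has degree $k_j$ is nonempty. Write $M=\sum_j k_j$, $M_2=\sum_j k_j(k_j-1)$, $k_{\max}=\max_j k_j$, $B_1=M_2/M$ and $B_2=(M_2/M)^2$. Take $M$ points grouped into $n$ cells, the $j$th cell containing $k_j$ labelled points. A *configuration* is a partition of the points into pairs; shrinking the cells to vertices turns a configuration $P$ into a multigraph $G(P)$. A *loop* is a pair inside one cell. A *double pair* (*triple pair*) is a set of two (three) distinct non-loop pairs between the same two cells. A configuration is *good* if every cell contains at most one loop, there are no triple pairs, and there are at most $B_1$ loops and at most $B_2$ double pairs. Let $\mathcal{C}_{\ell,d}$ be the set of good configurations with exactly $\ell$ loops and $d$ double pairs. **Switchings.** A *loop-switching* $P\mapsto P'$, given by an ordered 6-tuple of points $(a,b,x,y,c,e)$, replaces in a good configuration $P$ the loop $xy$ and the pairs $ab$, $ce$ by $ac$, $bx$, $ye$. A *double-switching*, given by an ordered 8-tuple $(a,b,c,d,e,f,g,h)$ with $b,c$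 in one cell and $f,g$ in one cell, replaces in a good configuration $P$ the double pair $\{bf,cg\}$ and the pairs $ae$, $dh$ by $ab$, $cd$, $ef$, $gh$. In both cases the cells involved (5, respectively 6) must be distinct, the removed pairs other than the chosen loop or double pair must not be in double pairs of $P$, and no new pair may join two cells that are already joined by a pair of $P$. For $X\in\{\text{loop},\text{double}\}$ let $f(P,X)$ be the number of $X$-switchings which may be applied to $P$, and $b(P',X)$ the number of $X$-switchings which produce $P'$. Put $\overline m(\ell,\text{loop})=2\ell M^2$ and $\overline m(d,\text{double})=4dM^2$. *Positive lower bounds* are positive real numbers $\underline m(\ell,d,\text{loop})$ (for integers $\ell,d\ge 0$ with $\ell+1\le B_1$, $d\le B_2$) and $\underline m(d,\text{double})$ (for integers $d\ge 0$ with $d+1\le B_2$) such that $b(P',\text{loop})\ge\underline m(\ell,d,\text{loop})$ for all $P'\in\mathcal{C}_{\ell,d}$ and $b(P',\text{double})\ge\underline m(d,\text{double})$ for all $P'\in\mathcal{C}_{0,d}$, for all indices in these ranges. The rejection probabilities are $$q_{\text{loop}}(P,P')=1-\frac{f(P,\text{loop})\,\underline m(\ell-1,d,\text{loop})}{\overline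 m(\ell,\text{loop})\,b(P',\text{loop})},\qquad q_{\text{double}}(P,P')=1-\frac{f(P,\text{double})\,\underline m(d-1,\text{double})}{\overline m(d,\text{double})\,b(P',\text{double})},$$ for loop-switchings $P\mapsto P'$ from $P\in\mathcal{C}_{\ell,d}$ with $\ell\ge1$, respectively double-switchings $P\mapsto P'$ from $P\in\mathcal{C}_{0,d}$ with $d\ge1$. **Algorithm (McKay–Wormald).** Choose configurations uniformly at random until one is good; call it $P$. While $P$ has a loop, choose a loop-switching $P\mapsto P'$ of $P$ uniformly at random, restart the whole algorithm with probability $q_{\text{loop}}(P,P')$, and otherwise replace $P$ by $P'$. Then, while $P$ has a double pair, do the same with double-switchings and $q_{\text{double}}$. Finally output $G(P)$. **Lemma.** If $k_{\max}^4=O(M)$, then the McKay–Wormald algorithm is well defined and its output is exactly uniform over $G(\boldsymbol{k})$. Precisely: for every real $C$ there is $M_0$ such that the following holds for every $n$ and every graphical $\boldsymbol{k}=(k_1,\dots,k_n)$ with $k_{\max}^4\le CM$ and $M\ge M_0$. 1. The expressions $$MM_2-\ell k_{\max}^2M-8dk_{\max}M-(2\ell+4d+6k_{\max}+2k_{\max}^2)M_2,\qquad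 M_2^2-(16dk_{\max}+9k_{\max}^2+3k_{\max}^3)M_2$$ are positive lower bounds $\underline m(\ell,d,\text{loop})$ and $\underline m(d,\text{double})$. 2. $f(P,\text{loop})\le\overline m(\ell,\text{loop})$ for $P\in\mathcal{C}_{\ell,d}$, and $f(P,\text{double})\le\overline m(d,\text{double})$ for $P\in\mathcal{C}_{0,d}$; moreover $f(P,\text{loop})>0$ if in addition $\ell\ge1$, and $f(P,\text{double})>0$ if in addition $d\ge1$. 3. For every choice of positive lower bounds $\underline m$: - every loop-switching from $P\in\mathcal{C}_{\ell,d}$ (with $\ell\ge1$) leads to some $P'\in\mathcal{C}_{\ell-1,d}$, every double-switching from $P\in\mathcal{C}_{0,d}$ (with $d\ge1$) leads to some $P'\in\mathcal{C}_{0,d-1}$, and in both cases $b(P',X)>0$ and $0\le q_X(P,P')<1$; - if $P$ is uniform on a nonempty $\mathcal{C}_{\ell,d}$ with $\ell\ge1$, then, conditioned on no restart in the next step (an event of positive probability), the configuration after that step is uniform on $\mathcal{C}_{\ell-1,d}$, which is nonempty; if $P$ is uniform on a nonempty $\mathcal{C}_{0,d}$ with $d\ge1$, the same holds with $\mathcal{C}_{0,d-1}$;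 - the algorithm terminates with probability one, and it outputs each $G\in G(\boldsymbol{k})$ with probability exactly $1/|G(\boldsymbol{k})|$ and every other graph with probability $0$. -/

import Mathlib

open scoped ENNReal

namespace McKayWormald

/-! ### Degree sequences -/

/-- `M = ∑ⱼ kⱼ`. -/
def degSum {n : ℕ} (k : Fin n → ℕ) : ℕ := ∑ j, k j

/-- `M₂ = ∑ⱼ kⱼ (kⱼ - 1)`, the number of ordered pairs of distinct points in a common cell. -/
def degSumTwo {n : ℕ} (k : Fin n → ℕ) : ℕ := ∑ j, k j * (k j - 1)

/-- The maximum degree `k_max`. -/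
def maxDeg {n : ℕ} (k : Fin n → ℕ) : ℕ := Finset.univ.sup k

/-- `B₁ = M₂ / M`. -/
noncomputable def loopCap {n : ℕ} (k : Fin n → ℕ) : ℝ := (degSumTwo k : ℝ) / degSum k

/-- `B₂ = (M₂ / M)²`. -/
noncomputable def doubleCap {n : ℕ} (k : Fin n → ℕ) : ℝ := ((degSumTwo k : ℝ) / degSum k) ^ 2

/-- `G(k)`: the simple graphs on the vertex set `[n]` with degree sequence `k`. -/
def graphsWithDegrees {n : ℕ} (k : Fin n → ℕ) : Set (SimpleGraph (Fin n)) :=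
  {G | ∀ v, (G.neighborSet v).ncard = k v}

/-- `k` is graphical if `G(k)` is nonempty. -/
def Graphical {n : ℕ} (k : Fin n → ℕ) : Prop := (graphsWithDegrees k).Nonempty

/-! ### Configurations -/

/-- The points: the cell of the vertex `j` contains `k j` labelled points.
The cell of a point `p` is `p.1`. -/
abbrev Point {n : ℕ} (k : Fin n → ℕ) : Type := Σ j : Fin n, Fin (k j)

/-- The configurations: partitions of the points into pairs. A partition into pairs is given by the
map that sends every point to its partner, that is, by an involution without fixed points. -/
abbrev Configuration {n : ℕ} (k : Fin n → ℕ) : Type :=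
  {P : Point k → Point k // (∀ p, P (P p) = p) ∧ ∀ p, P p ≠ p}

/-- The number of points of the cell `u` whose partner is in the cell `v`. For `u ≠ v` this is
the number of pairs of `P` between the cells `u` and `v`; for `u = v` every loop at `u` is counted
twice, once for each of its points. -/
def mult {n : ℕ} {k : Fin n → ℕ} (P : Configuration k) (u v : Fin n) : ℕ :=
  (Finset.univ.filter fun p : Point k => p.1 = u ∧ (P.1 p).1 = v).card

/-- The number of loops in the cell `v`. -/
def loopsAt {n : ℕ} {k : Fin n → ℕ} (P : Configuration k) (v : Fin n) : ℕ := mult P v v / 2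

/-- The number of loops. -/
def numLoops {n : ℕ} {k : Fin n → ℕ} (P : Configuration k) : ℕ := ∑ v, loopsAt P v

/-- The number of double pairs: sets of two distinct non-loop pairs between the same two cells. -/
def numDoubles {n : ℕ} {k : Fin n → ℕ} (P : Configuration k) : ℕ :=
  ∑ u, ∑ v ∈ Finset.univ.filter (fun v => u < v), (mult P u v).choose 2

/-- Good configurations: every cell contains at most one loop, there is no triple pair, and there
are at most `B₁` loops and at most `B₂` double pairs. -/
structure IsGood {n : ℕ} {k : Fin n → ℕ} (P : Configuration k) : Prop where
  loopsAt_le_one : ∀ v, loopsAt P v ≤ 1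
  no_triple : ∀ u v, u ≠ v → mult P u v ≤ 2
  numLoops_le : (numLoops P : ℝ) ≤ loopCap k
  numDoubles_le : (numDoubles P : ℝ) ≤ doubleCap k

/-- `C_{ℓ,d}`: the good configurations with exactly `ℓ` loops and `d` double pairs. -/
def goodWith {n : ℕ} (k : Fin n → ℕ) (l d : ℕ) : Set (Configuration k) :=
  {P | IsGood P ∧ numLoops P = l ∧ numDoubles P = d}

/-- The simple graph obtained from a configuration by shrinking every cell to a vertex and
replacing every pair by an edge (loops and multiplicities, if there are any, are forgotten). -/
def toGraph {n : ℕ} {k : Fin n → ℕ} (P : Configuration k) : SimpleGraph (Fin n) :=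
  SimpleGraph.fromRel fun u v => ∃ p : Point k, p.1 = u ∧ (P.1 p).1 = v

/-! ### Switchings -/

/-- `P ↦ P'` is the loop-switching specified by the ordered 6-tuple `s = (a, b, x, y, c, d)`:
the loop `xy` and the pairs `ab`, `cd` of the good configuration `P` are replaced by the pairs
`ac`, `bx`, `yd`. The five cells involved are distinct, no pair that is removed (other than the
loop) was part of a double pair, and no pair that is created is part of a double pair, so that
the number of loops drops by one and no other loop or double pair is destroyed or created. -/
structure IsLoopSwitching {n : ℕ} {k : Fin n → ℕ} (P P' : Configuration k)
    (s : Fin 6 → Point k) : Prop where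
  good : IsGood P
  -- the pairs removed
  pair_ab : P.1 (s 0) = s 1
  pair_xy : P.1 (s 2) = s 3
  pair_cd : P.1 (s 4) = s 5
  -- the loop, and the five distinct cells
  same_cell : (s 2).1 = (s 3).1
  cells : [(s 0).1, (s 1).1, (s 2).1, (s 4).1, (s 5).1].Nodup
  -- the removed pairs `ab`, `cd` are not in double pairs
  single_ab : mult P (s 0).1 (s 1).1 = 1
  single_cd : mult P (s 4).1 (s 5).1 = 1
  -- the created pairs are not repeated
  new_ac : mult P (s 0).1 (s 4).1 = 0
  new_bx : mult P (s 1).1 (s 2).1 = 0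
  new_yd : mult P (s 3).1 (s 5).1 = 0
  -- the result
  result_ac : P'.1 (s 0) = s 4
  result_bx : P'.1 (s 1) = s 2
  result_yd : P'.1 (s 3) = s 5
  rest : ∀ z, (∀ i, z ≠ s i) → P'.1 z = P.1 z

/-- `P ↦ P'` is the double-switching specified by the ordered 8-tuple
`s = (a, b, c, d, e, f, g, h)`: the double pair `bf`, `cg` and the pairs `ae`, `dh` of the good
configuration `P` are replaced by the pairs `ab`, `cd`, `ef`, `gh`. Here `b, c` are in one cell and
`f, g` are in one cell. The six cells involved are distinct, the pairs `ae`, `dh` were not part of a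
double pair, and no pair that is created is part of a double pair, so that the number of double
pairs drops by one and no other loop or double pair is destroyed or created. -/
structure IsDoubleSwitching {n : ℕ} {k : Fin n → ℕ} (P P' : Configuration k)
    (s : Fin 8 → Point k) : Prop where
  good : IsGood P
  -- the pairs removed
  pair_ae : P.1 (s 0) = s 4
  pair_bf : P.1 (s 1) = s 5
  pair_cg : P.1 (s 2) = s 6
  pair_dh : P.1 (s 3) = s 7
  -- the double pair, and the six distinct cells
  b_ne_c : s 1 ≠ s 2
  same_cell_bc : (s 1).1 = (s 2).1
  same_cell_fg : (s 5).1 = (s 6).1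
  cells : [(s 0).1, (s 1).1, (s 3).1, (s 4).1, (s 5).1, (s 7).1].Nodup
  -- the removed pairs `ae`, `dh` are not in double pairs
  single_ae : mult P (s 0).1 (s 4).1 = 1
  single_dh : mult P (s 3).1 (s 7).1 = 1
  -- the created pairs are not repeated
  new_ab : mult P (s 0).1 (s 1).1 = 0
  new_cd : mult P (s 2).1 (s 3).1 = 0
  new_ef : mult P (s 4).1 (s 5).1 = 0
  new_gh : mult P (s 6).1 (s 7).1 = 0
  -- the result
  result_ab : P'.1 (s 0) = s 1
  result_cd : P'.1 (s 2) = s 3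
  result_ef : P'.1 (s 4) = s 5
  result_gh : P'.1 (s 6) = s 7
  rest : ∀ z, (∀ i, z ≠ s i) → P'.1 z = P.1 z

open Classical in
/-- The loop-switchings which may be applied to `P`, each together with its result. -/
noncomputable def loopSwitchings {n : ℕ} {k : Fin n → ℕ} (P : Configuration k) :
    Finset ((Fin 6 → Point k) × Configuration k) :=
  Finset.univ.filter fun x => IsLoopSwitching P x.2 x.1

open Classical in
/-- The double-switchings which may be applied to `P`, each together with its result. -/
noncomputable def doubleSwitchings {n : ℕ} {k : Fin n → ℕ} (P : Configuration k) :
    Finset ((Fin 8 → Point k) × Configuration k) :=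
  Finset.univ.filter fun x => IsDoubleSwitching P x.2 x.1

/-- `f(P, loop)`: the number of loop-switchings which may be applied to `P`. -/
noncomputable def fLoop {n : ℕ} {k : Fin n → ℕ} (P : Configuration k) : ℕ :=
  (loopSwitchings P).card

/-- `f(P, double)`: the number of double-switchings which may be applied to `P`. -/
noncomputable def fDouble {n : ℕ} {k : Fin n → ℕ} (P : Configuration k) : ℕ :=
  (doubleSwitchings P).card

open Classical in
/-- `b(P', loop)`: the number of ways to produce `P'` by a loop-switching. -/
noncomputable def bLoop {n : ℕ} {k : Fin n → ℕ} (P' : Configuration k) : ℕ :=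
  (Finset.univ.filter fun x : (Fin 6 → Point k) × Configuration k =>
    IsLoopSwitching x.2 P' x.1).card

open Classical in
/-- `b(P', double)`: the number of ways to produce `P'` by a double-switching. -/
noncomputable def bDouble {n : ℕ} {k : Fin n → ℕ} (P' : Configuration k) : ℕ :=
  (Finset.univ.filter fun x : (Fin 8 → Point k) × Configuration k =>
    IsDoubleSwitching x.2 P' x.1).card

/-! ### Bounds and rejection probabilities -/

/-- The upper bound `2 ℓ M²` for `f(P, loop)`. -/
def upperLoop {n : ℕ} (k : Fin n → ℕ) (l : ℕ) : ℕ := 2 * l * degSum k ^ 2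

/-- The upper bound `4 d M²` for `f(P, double)`. -/
def upperDouble {n : ℕ} (k : Fin n → ℕ) (d : ℕ) : ℕ := 4 * d * degSum k ^ 2

/-- `mL ℓ d` and `mD d` are positive lower bounds for `b(P', loop)` with `P'` in `C_{ℓ,d}`, and for
`b(P', double)` with `P'` in `C_{0,d}`. This is asked for in the range in which the rejection
probabilities use them: `P'` is the result of a switching, so the configuration before it has
`ℓ + 1 ≤ B₁` loops, or `d + 1 ≤ B₂` double pairs. -/
structure AreLowerBounds {n : ℕ} (k : Fin n → ℕ) (mL : ℕ → ℕ → ℝ) (mD : ℕ → ℝ) : Prop where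
  loop_pos : ∀ l d : ℕ, (l : ℝ) + 1 ≤ loopCap k → (d : ℝ) ≤ doubleCap k → 0 < mL l d
  loop_le : ∀ l d : ℕ, (l : ℝ) + 1 ≤ loopCap k → (d : ℝ) ≤ doubleCap k →
    ∀ P' ∈ goodWith k l d, mL l d ≤ bLoop P'
  double_pos : ∀ d : ℕ, (d : ℝ) + 1 ≤ doubleCap k → 0 < mD d
  double_le : ∀ d : ℕ, (d : ℝ) + 1 ≤ doubleCap k → ∀ P' ∈ goodWith k 0 d, mD d ≤ bDouble P'

/-- An explicit expression for a lower bound for `b(P', loop)` on `C_{ℓ,d}`: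
`M M₂ - ℓ k_max² M - 8 d k_max M - (2ℓ + 4d + 6 k_max + 2 k_max²) M₂`. -/
noncomputable def explicitLoop {n : ℕ} (k : Fin n → ℕ) (l d : ℕ) : ℝ :=
  (degSum k : ℝ) * degSumTwo k - l * (maxDeg k : ℝ) ^ 2 * degSum k - 8 * d * maxDeg k * degSum k
    - (2 * l + 4 * d + 6 * maxDeg k + 2 * (maxDeg k : ℝ) ^ 2) * degSumTwo k

/-- An explicit expression for a lower bound for `b(P', double)` on `C_{0,d}`:
`M₂² - (16 d k_max + 9 k_max² + 3 k_max³) M₂`. -/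
noncomputable def explicitDouble {n : ℕ} (k : Fin n → ℕ) (d : ℕ) : ℝ :=
  (degSumTwo k : ℝ) ^ 2
    - (16 * d * maxDeg k + 9 * (maxDeg k : ℝ) ^ 2 + 3 * (maxDeg k : ℝ) ^ 3) * degSumTwo k

/-- The rejection probability `q_loop(P, P')`, for `P` in `C_{ℓ,d}` with `ℓ ≥ 1`. -/
noncomputable def qLoop {n : ℕ} {k : Fin n → ℕ} (mL : ℕ → ℕ → ℝ) (P P' : Configuration k) : ℝ :=
  1 - (fLoop P * mL (numLoops P - 1) (numDoubles P)) / (upperLoop k (numLoops P) * bLoop P')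

/-- The rejection probability `q_double(P, P')`, for `P` in `C_{0,d}` with `d ≥ 1`. -/
noncomputable def qDouble {n : ℕ} {k : Fin n → ℕ} (mD : ℕ → ℝ) (P P' : Configuration k) : ℝ :=
  1 - (fDouble P * mD (numDoubles P - 1)) / (upperDouble k (numDoubles P) * bDouble P')

/-! ### The algorithm, as a Markov chain -/

/-- A state of the algorithm: it is about to choose a random configuration, or it has the current
configuration `P`, or it has terminated with the output `G`. -/
inductive State {n : ℕ} (k : Fin n → ℕ) : Type
  | start : State k
  | run (P : Configuration k) : State k
  | done (G : SimpleGraph (Fin n)) : State k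

/-- A coin which shows `true` with probability `q` (truncated to `[0,1]`). -/
noncomputable def coin (q : ℝ) : PMF Bool :=
  PMF.ofFintype (fun b => if b then min 1 (ENNReal.ofReal q) else 1 - min 1 (ENNReal.ofReal q))
    (by simp)

open Classical in
/-- Choose a configuration uniformly at random and keep it if it is good, otherwise repeat. -/
noncomputable def initialStep {n : ℕ} (k : Fin n → ℕ) : PMF (State k) :=
  if h : (Finset.univ : Finset (Configuration k)).Nonempty then
    (PMF.uniformOfFinset Finset.univ h).map fun P => if IsGood P then .run P else .start
  else PMF.pure .start

open Classical in
/-- Choose a loop-switching `P ↦ P'` uniformly at random, restart with probability `q_loop(P, P')`,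
otherwise continue with `P'`. (If there were no loop-switching to choose from, restart.) -/
noncomputable def loopStep {n : ℕ} {k : Fin n → ℕ} (mL : ℕ → ℕ → ℝ) (P : Configuration k) :
    PMF (State k) :=
  if h : (loopSwitchings P).Nonempty then
    (PMF.uniformOfFinset (loopSwitchings P) h).bind fun x =>
      (coin (qLoop mL P x.2)).map fun reject => if reject then .start else .run x.2
  else PMF.pure .start

open Classical in
/-- Choose a double-switching `P ↦ P'` uniformly at random, restart with probability
`q_double(P, P')`, otherwise continue with `P'`. (If there were no double-switching to choose from,
restart.) -/
noncomputable def doubleStep {n : ℕ} {k : Fin n → ℕ} (mD : ℕ → ℝ) (P : Configuration k) :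
    PMF (State k) :=
  if h : (doubleSwitchings P).Nonempty then
    (PMF.uniformOfFinset (doubleSwitchings P) h).bind fun x =>
      (coin (qDouble mD P x.2)).map fun reject => if reject then .start else .run x.2
  else PMF.pure .start

/-- One step of the McKay–Wormald algorithm with the lower bounds `mL`, `mD`. -/
noncomputable def step {n : ℕ} {k : Fin n → ℕ} (mL : ℕ → ℕ → ℝ) (mD : ℕ → ℝ) :
    State k → PMF (State k)
  | .start => initialStep k
  | .run P =>
      if 0 < numLoops P then loopStep mL P
      else if 0 < numDoubles P then doubleStep mD P
      else PMF.pure (.done (toGraph P))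
  | .done G => PMF.pure (.done G)

/-- The law of the state after `t` steps of the algorithm. -/
noncomputable def law {n : ℕ} (k : Fin n → ℕ) (mL : ℕ → ℕ → ℝ) (mD : ℕ → ℝ) : ℕ → PMF (State k)
  | 0 => PMF.pure .start
  | t + 1 => (law k mL mD t).bind (step mL mD)

/-- The probability that the algorithm terminates with output `G`. (The event that it has done so
within `t` steps increases with `t`.) -/
noncomputable def outputProb {n : ℕ} (k : Fin n → ℕ) (mL : ℕ → ℕ → ℝ) (mD : ℕ → ℝ)
    (G : SimpleGraph (Fin n)) : ℝ≥0∞ :=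
  ⨆ t, law k mL mD t (.done G)

/-- Conditioned on not restarting, one step of the algorithm maps the uniform distribution on the
set `C` of configurations to the uniform distribution on the set `C'`: if `P` is uniform on `C`
then the current configuration after the step is equal to `Q` with some positive probability `a`
that is the same for all `Q` in `C'`, and never outside `C'`. -/
def StepMapsUniform {n : ℕ} {k : Fin n → ℕ} (mL : ℕ → ℕ → ℝ) (mD : ℕ → ℝ)
    (C C' : Set (Configuration k)) : Prop :=
  C'.Nonempty ∧ ∃ a : ℝ≥0∞, 0 < a ∧ ∀ Q : Configuration k,
    (Q ∈ C' → (C.ncard : ℝ≥0∞)⁻¹ * ∑ P ∈ C.toFinite.toFinset, step mL mD (.run P) (.run Q) = a) ∧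
    (Q ∉ C' → (C.ncard : ℝ≥0∞)⁻¹ * ∑ P ∈ C.toFinite.toFinset, step mL mD (.run P) (.run Q) = 0)

end McKayWormald

open McKayWormald

/-! Uniformity comes from a cancellation. Let P be uniform on C_{ℓ,d} and fix Q in C_{ℓ-1,d}. A
given switching P ↦ Q is chosen with probability 1/f(P) and accepted with probability f(P) m / (U
b(Q)), where the lower bound m and the upper bound U depend on (ℓ,d) only. The product m / (U b(Q))
no longer involves P. A switching removes exactly one loop and changes no other loop or double pair,
so all b(Q) switchings that produce Q start in C_{ℓ,d}, and Q receives total mass proportional to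
m/U, whatever Q is. Double-switchings behave in the same way. This is
`stepMapsUniform_of_switching`.

Restarts need no conditioning on the history: at every fixed time the law gives equal mass to all
configurations of the same class, and this survives a step (`isSymmetricLaw_law`). Every graph in
G(k) comes from the same number ∏ k_j! of simple configurations (`ncard_simpleOver_of_mem`), so at
every time the mass already output is the same for all graphs in G(k).

Termination rests on G(k) being nonempty: some configuration is simple, and each fresh draw may hit
it. A potential whose expectation drops by at least one per step bounds the expected running time
(`sum_expect_notDone_le`). Total mass one, shared equally, is then the uniform law.

The acceptance probabilities lie in (0,1] because of elementary counts. A switching is determined by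
a defect and two more points, which gives U. Conversely, its points can be chosen one after the
other, and the excluded choices are few: a good configuration has at most k_max loops and k_max²
double pairs. The growth condition enters only through 100 k_max³ < M, valid for large M
(`exists_threshold`). -/

namespace McKayWormald

/-! ### Multiplicities, elementary counts of points, and local changes of a configuration. -/

section Basics

variable {n : ℕ} {k : Fin n → ℕ}

theorem Configuration.injective (P : Configuration k) : Function.Injective P.1 :=
  Function.LeftInverse.injective P.2.1

theorem mult_comm (P : Configuration k) (u v : Fin n) : mult P u v = mult P v u := by
  unfold mult
  refine Finset.card_bij' (fun p _ => P.1 p) (fun p _ => P.1 p) ?_ ?_ ?_ ?_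
  · intro p hp
    simp only [Finset.mem_filter, Finset.mem_univ, true_and] at hp ⊢
    exact ⟨hp.2, by rw [P.2.1]; exact hp.1⟩
  · intro p hp
    simp only [Finset.mem_filter, Finset.mem_univ, true_and] at hp ⊢
    exact ⟨hp.2, by rw [P.2.1]; exact hp.1⟩
  · intro p _; exact P.2.1 p
  · intro p _; exact P.2.1 p

/-- The configuration restricts to a fixed-point-free involution of the counted points. Hence the
division by 2 in `loopsAt` is exact. -/
theorem even_mult_self (P : Configuration k) (v : Fin n) : Even (mult P v v) := by
  have h : ∑ p ∈ Finset.univ.filter (fun p : Point k => p.1 = v ∧ (P.1 p).1 = v), (1 : ZMod 2) = 0 :=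
    Finset.sum_involution (fun p _ => P.1 p) (fun _ _ => by decide) (fun p _ _ => P.2.2 p)
      (fun p hp => by
        simp only [Finset.mem_filter, Finset.mem_univ, true_and] at hp ⊢
        exact ⟨hp.2, by rw [P.2.1]; exact hp.1⟩) (fun p _ => P.2.1 p)
  rw [Finset.sum_const, nsmul_eq_mul, mul_one] at h
  exact (ZMod.natCast_eq_zero_iff_even).1 h

theorem two_mul_loopsAt (P : Configuration k) (v : Fin n) : 2 * loopsAt P v = mult P v v :=
  Nat.two_mul_div_two_of_even (even_mult_self P v)

/-- The points which lie in loops. -/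
def loopPoints (P : Configuration k) : Finset (Point k) :=
  Finset.univ.filter fun p => p.1 = (P.1 p).1

/-- The points which lie in double pairs. -/
def doublePoints (P : Configuration k) : Finset (Point k) :=
  Finset.univ.filter fun p => p.1 ≠ (P.1 p).1 ∧ 2 ≤ mult P p.1 (P.1 p).1

theorem mem_loopPoints {P : Configuration k} {p : Point k} :
    p ∈ loopPoints P ↔ p.1 = (P.1 p).1 := by simp [loopPoints]

theorem mem_doublePoints {P : Configuration k} {p : Point k} :
    p ∈ doublePoints P ↔ p.1 ≠ (P.1 p).1 ∧ 2 ≤ mult P p.1 (P.1 p).1 := by simp [doublePoints]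

theorem mult_pos (P : Configuration k) (p : Point k) : 0 < mult P p.1 (P.1 p).1 :=
  Finset.card_pos.2 ⟨p, by simp⟩

theorem mult_eq_one_of_notMem {P : Configuration k} {p : Point k} (h : p.1 ≠ (P.1 p).1)
    (hp : p ∉ doublePoints P) : mult P p.1 (P.1 p).1 = 1 := by
  rw [mem_doublePoints] at hp
  have := mult_pos P p
  by_contra h1
  exact hp ⟨h, by omega⟩

theorem card_loopPoints (P : Configuration k) : (loopPoints P).card = 2 * numLoops P := by
  rw [Finset.card_eq_sum_card_fiberwise (f := fun p : Point k => p.1) (t := Finset.univ)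
    (fun _ _ => by simp), numLoops, Finset.mul_sum]
  refine Finset.sum_congr rfl fun v _ => ?_
  rw [two_mul_loopsAt, mult, loopPoints, Finset.filter_filter]
  congr 1
  ext p
  simp only [Finset.mem_filter, Finset.mem_univ, true_and]
  constructor
  · rintro ⟨h, rfl⟩; exact ⟨rfl, h.symm⟩
  · rintro ⟨rfl, h⟩; exact ⟨h.symm, rfl⟩

/-- A multiplicity m ≥ 2 satisfies m ≤ m(m-1) = 2·(m choose 2), and each unordered pair of cells is
seen from both of its ends. Goodness is not needed; without triple pairs the bound is an equality.
-/
theorem card_doublePoints_le (P : Configuration k) :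
    (doublePoints P).card ≤ 4 * numDoubles P := by
  have key : ∀ u v : Fin n,
      ((doublePoints P).filter fun p => (p.1, (P.1 p).1) = (u, v)).card ≤
        (if u < v then 2 * (mult P u v).choose 2 else 0) +
          (if v < u then 2 * (mult P v u).choose 2 else 0) := by
    intro u v
    by_cases h : u ≠ v ∧ 2 ≤ mult P u v
    · have h1 : ((doublePoints P).filter fun p => (p.1, (P.1 p).1) = (u, v)).card ≤ mult P u v := by
        refine Finset.card_le_card fun p hp => ?_
        simp only [Finset.mem_filter, Prod.mk.injEq] at hp
        simp [hp.2]
      have h2 : mult P u v ≤ 2 * (mult P u v).choose 2 := by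
        obtain ⟨m, hm⟩ := Nat.exists_eq_add_of_le h.2
        rw [hm, Nat.choose_two_right, Nat.two_mul_div_two_of_even (Nat.even_mul_pred_self _)]
        exact Nat.le_mul_of_pos_right _ (by omega)
      rcases lt_or_gt_of_ne h.1 with h3 | h3
      · rw [if_pos h3]; omega
      · rw [if_pos h3, mult_comm P v u]; omega
    · rw [Finset.card_eq_zero.2]
      · exact Nat.zero_le _
      · refine Finset.filter_eq_empty_iff.2 fun p hp hpe => h ?_
        rw [mem_doublePoints] at hp
        simp only [Prod.mk.injEq] at hpe
        rwa [hpe.1, hpe.2] at hp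
  rw [Finset.card_eq_sum_card_fiberwise (f := fun p : Point k => (p.1, (P.1 p).1))
    (t := Finset.univ) (fun _ _ => by simp), Fintype.sum_prod_type]
  calc _ ≤ ∑ u, ∑ v, ((if u < v then 2 * (mult P u v).choose 2 else 0) +
          (if v < u then 2 * (mult P v u).choose 2 else 0)) :=
        Finset.sum_le_sum fun u _ => Finset.sum_le_sum fun v _ => key u v
    _ = ∑ u, ∑ v, (if u < v then 2 * (mult P u v).choose 2 else 0) +
        ∑ u, ∑ v, (if u < v then 2 * (mult P u v).choose 2 else 0) := by
        simp only [Finset.sum_add_distrib]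
        congr 1
        exact Finset.sum_comm
    _ = 4 * numDoubles P := by
        simp only [numDoubles, Finset.sum_filter, Finset.mul_sum, mul_ite, mul_zero,
          ← Finset.sum_add_distrib]
        refine Finset.sum_congr rfl fun u _ => Finset.sum_congr rfl fun v _ => ?_
        split_ifs <;> ring

/-! ### Sizes -/

theorem card_point (k : Fin n → ℕ) : Fintype.card (Point k) = degSum k := by
  simp [degSum]

theorem le_maxDeg (k : Fin n → ℕ) (v : Fin n) : k v ≤ maxDeg k :=
  Finset.le_sup (f := k) (Finset.mem_univ v)

theorem card_cell (v : Fin n) :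
    (Finset.univ.filter fun p : Point k => p.1 = v).card = k v := by
  have : (Finset.univ.filter fun p : Point k => p.1 = v) =
      Finset.univ.map (Function.Embedding.sigmaMk (β := fun j => Fin (k j)) v) := by
    ext ⟨w, i⟩
    simp only [Finset.mem_filter, Finset.mem_univ, true_and, Finset.mem_map,
      Function.Embedding.sigmaMk_apply]
    constructor
    · rintro rfl; exact ⟨i, rfl⟩
    · rintro ⟨j, hj⟩; exact (congrArg Sigma.fst hj).symm
  rw [this]; simp

theorem card_cell_le (v : Fin n) :
    (Finset.univ.filter fun p : Point k => p.1 = v).card ≤ maxDeg k := by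
  rw [card_cell]; exact le_maxDeg k v

theorem card_mem_cells_le (S : Finset (Fin n)) :
    (Finset.univ.filter fun p : Point k => p.1 ∈ S).card ≤ S.card * maxDeg k := by
  have : (Finset.univ.filter fun p : Point k => p.1 ∈ S) =
      S.biUnion fun v => Finset.univ.filter fun p : Point k => p.1 = v := by
    ext p; simp
  rw [this]
  exact Finset.card_biUnion_le_card_mul _ _ _ fun v _ => card_cell_le v

theorem card_filter_partner (P : Configuration k) (p : Point k → Prop) [DecidablePred p] :
    (Finset.univ.filter fun z : Point k => p (P.1 z)).card = (Finset.univ.filter p).card := by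
  refine Finset.card_bij' (fun z _ => P.1 z) (fun z _ => P.1 z) ?_ ?_ ?_ ?_ <;>
    simp [P.2.1]

/-- The cell `w` has at most k_max points, hence partners in at most k_max cells, each with at most
k_max points. -/
theorem card_linked_le (P : Configuration k) (w : Fin n) :
    (Finset.univ.filter fun p : Point k => mult P w p.1 ≠ 0).card ≤ maxDeg k ^ 2 := by
  have : (Finset.univ.filter fun p : Point k => mult P w p.1 ≠ 0) ⊆
      Finset.univ.filter fun p : Point k => p.1 ∈
        (Finset.univ.filter fun q : Point k => q.1 = w).image fun q => (P.1 q).1 := by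
    intro p hp
    simp only [Finset.mem_filter, Finset.mem_univ, true_and, Finset.mem_image] at hp ⊢
    obtain ⟨q, hq⟩ := Finset.card_pos.1 (Nat.pos_of_ne_zero hp)
    simp only [Finset.mem_filter, Finset.mem_univ, true_and] at hq
    exact ⟨q, hq⟩
  refine (Finset.card_le_card this).trans ((card_mem_cells_le _).trans ?_)
  rw [sq]
  exact Nat.mul_le_mul_right _ (Finset.card_image_le.trans (card_cell_le w))

theorem degSumTwo_le (k : Fin n → ℕ) : degSumTwo k ≤ maxDeg k * degSum k := by
  rw [degSumTwo, degSum, Finset.mul_sum]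
  refine Finset.sum_le_sum fun v _ => ?_
  rw [mul_comm]
  exact Nat.mul_le_mul_right _ ((Nat.sub_le _ _).trans (le_maxDeg k v))

/-- The ordered pairs of distinct points in a common cell. -/
def cellPairs (k : Fin n → ℕ) : Finset (Point k × Point k) :=
  Finset.univ.filter fun x => x.1.1 = x.2.1 ∧ x.1 ≠ x.2

theorem mem_cellPairs {x : Point k × Point k} :
    x ∈ cellPairs k ↔ x.1.1 = x.2.1 ∧ x.1 ≠ x.2 := by simp [cellPairs]

theorem card_cellPairs_fiber (p : Point k) :
    ((cellPairs k).filter fun x => x.1 = p).card = k p.1 - 1 := by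
  rw [← card_cell (k := k) p.1, ← Finset.card_erase_of_mem (a := p) (by simp)]
  refine Finset.card_bij' (fun x _ => x.2) (fun q _ => (p, q)) ?_ ?_ ?_ ?_
  · intro x hx
    rw [Finset.mem_filter, mem_cellPairs] at hx
    obtain ⟨⟨h1, h2⟩, rfl⟩ := hx
    simp [h1, h2.symm]
  · intro q hq
    simp only [Finset.mem_erase, Finset.mem_filter, Finset.mem_univ, true_and] at hq
    simp [mem_cellPairs, hq.2, Ne.symm hq.1]
  · intro x hx
    rw [Finset.mem_filter] at hx
    rw [← hx.2]
  · intro q _; rfl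

theorem card_cellPairs (k : Fin n → ℕ) : (cellPairs k).card = degSumTwo k := by
  rw [Finset.card_eq_sum_card_fiberwise (f := fun x : Point k × Point k => x.1)
    (t := Finset.univ) (fun _ _ => by simp)]
  simp only [card_cellPairs_fiber]
  rw [Fintype.sum_sigma, degSumTwo]
  simp

theorem card_cellPairs_fst_mem_le (S : Finset (Point k)) :
    ((cellPairs k).filter fun x => x.1 ∈ S).card ≤ S.card * maxDeg k := by
  have : ((cellPairs k).filter fun x => x.1 ∈ S) =
      S.biUnion fun p => (cellPairs k).filter fun x => x.1 = p := by
    ext x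
    simp only [Finset.mem_filter, Finset.mem_biUnion]
    exact ⟨fun h => ⟨x.1, h.2, h.1, rfl⟩, fun ⟨p, h1, h2, h3⟩ => ⟨h2, h3 ▸ h1⟩⟩
  rw [this]
  refine Finset.card_biUnion_le_card_mul _ _ _ fun p _ => ?_
  rw [card_cellPairs_fiber]
  exact (Nat.sub_le _ _).trans (le_maxDeg k _)

/-- Swapping the two coordinates preserves `cellPairs`. -/
theorem card_cellPairs_snd_mem_le (S : Finset (Point k)) :
    ((cellPairs k).filter fun x => x.2 ∈ S).card ≤ S.card * maxDeg k := by
  refine le_trans (le_of_eq ?_) (card_cellPairs_fst_mem_le S)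
  refine Finset.card_bij' (fun x _ => x.swap) (fun x _ => x.swap) ?_ ?_ ?_ ?_ <;>
    simp +contextual [mem_cellPairs, eq_comm]

theorem card_cellPairs_cell_mem_le (S : Finset (Fin n)) :
    ((cellPairs k).filter fun x => x.1.1 ∈ S).card ≤ S.card * maxDeg k ^ 2 := by
  have := card_cellPairs_fst_mem_le (Finset.univ.filter fun p : Point k => p.1 ∈ S)
  simp only [Finset.mem_filter, Finset.mem_univ, true_and] at this
  refine this.trans ?_
  rw [sq, ← mul_assoc]
  exact Nat.mul_le_mul_right _ (card_mem_cells_le S)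

theorem card_loop_cells_le (P : Configuration k) :
    (Finset.univ.filter fun v => mult P v v ≠ 0).card ≤ numLoops P := by
  rw [Finset.card_filter, numLoops]
  refine Finset.sum_le_sum fun v _ => ?_
  have := two_mul_loopsAt P v
  split_ifs <;> omega

/-! ### Changing the partners of a few points -/

/-- `P` and `Q` agree outside the distinct points `t i`, which are paired according to `σ` in `P`
and according to `τ` in `Q`. -/
structure Rewired {m : ℕ} (P Q : Configuration k) (t : Fin m → Point k) (σ τ : Fin m → Fin m) :
    Prop where
  inj : Function.Injective t
  left : ∀ i, P.1 (t i) = t (σ i)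
  right : ∀ i, Q.1 (t i) = t (τ i)
  rest : ∀ z, (∀ i, z ≠ t i) → Q.1 z = P.1 z

theorem Rewired.symm {m : ℕ} {P Q : Configuration k} {t : Fin m → Point k} {σ τ : Fin m → Fin m}
    (h : Rewired P Q t σ τ) : Rewired Q P t τ σ :=
  ⟨h.inj, h.right, h.left, fun z hz => (h.rest z hz).symm⟩

/-- The points `t i` are closed under `P`, so the remaining points are too. The two parts can
therefore be paired independently: by `τ` on the first and by `P` on the second. -/
theorem exists_rewired {m : ℕ} (P : Configuration k) (t : Fin m → Point k) (σ τ : Fin m → Fin m)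
    (ht : Function.Injective t) (hσ : ∀ i, P.1 (t i) = t (σ i)) (hτ : ∀ i, τ (τ i) = i)
    (hτ' : ∀ i, τ i ≠ i) : ∃ Q : Configuration k, Rewired P Q t σ τ := by
  classical
  let f : Point k → Point k := fun z => if h : ∃ i, t i = z then t (τ h.choose) else P.1 z
  have f1 : ∀ i, f (t i) = t (τ i) := by
    intro i
    have h : ∃ j, t j = t i := ⟨i, rfl⟩
    simp only [f, dif_pos h]
    rw [ht h.choose_spec]
  have f2 : ∀ z, (∀ i, z ≠ t i) → f z = P.1 z := by
    intro z hz
    have h : ¬ ∃ j, t j = z := fun ⟨j, hj⟩ => hz j hj.symm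
    simp only [f, dif_neg h]
  have f3 : ∀ z, (∀ i, z ≠ t i) → ∀ i, P.1 z ≠ t i := by
    intro z hz i hi
    apply hz (σ i)
    rw [← hσ, ← hi, P.2.1]
  refine ⟨⟨f, ?_, ?_⟩, ht, hσ, f1, f2⟩
  · intro z
    by_cases h : ∃ i, z = t i
    · obtain ⟨i, rfl⟩ := h
      rw [f1, f1, hτ]
    · push Not at h
      rw [f2 z h, f2 _ (f3 z h), P.2.1]
  · intro z
    by_cases h : ∃ i, z = t i
    · obtain ⟨i, rfl⟩ := h
      rw [f1]
      exact fun h => hτ' i (ht h)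
    · push Not at h
      rw [f2 z h]
      exact P.2.2 z

theorem Rewired.unique {m : ℕ} {P Q Q' : Configuration k} {t : Fin m → Point k}
    {σ τ : Fin m → Fin m} (h : Rewired P Q t σ τ) (h' : Rewired P Q' t σ τ) : Q = Q' := by
  apply Subtype.ext
  funext z
  by_cases hz : ∃ i, z = t i
  · obtain ⟨i, rfl⟩ := hz
    rw [h.right, h'.right]
  · push Not at hz
    rw [h.rest z hz, h'.rest z hz]

/-- The indicator of `(a, b) = (u, v)`. -/
def arcInd (a b u v : Fin n) : ℕ := if a = u ∧ b = v then 1 else 0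

theorem arcInd_eq_zero_left {a b u v : Fin n} (h : a ≠ u) : arcInd a b u v = 0 := by
  simp [arcInd, h]

/-- Each multiplicity splits into the contribution of the points `t i` and that of the other points,
and the latter is common to `P` and `Q`. The balance is written with sums on both sides to avoid
subtraction in ℕ. -/
theorem Rewired.mult_eq {m : ℕ} {P Q : Configuration k} {t : Fin m → Point k}
    {σ τ : Fin m → Fin m} (h : Rewired P Q t σ τ) (u v : Fin n) :
    mult P u v + ∑ i, arcInd (t i).1 (t (τ i)).1 u v =
      mult Q u v + ∑ i, arcInd (t i).1 (t (σ i)).1 u v := by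
  classical
  unfold arcInd
  have key : ∀ (R : Configuration k) (ρ : Fin m → Fin m), (∀ i, R.1 (t i) = t (ρ i)) →
      mult R u v = ∑ i, (if (t i).1 = u ∧ (t (ρ i)).1 = v then 1 else 0) +
        ∑ z ∈ (Finset.univ.image t)ᶜ, (if z.1 = u ∧ (R.1 z).1 = v then 1 else 0) := by
    intro R ρ hρ
    rw [mult, Finset.card_filter, ← Finset.sum_add_sum_compl (Finset.univ.image t),
      Finset.sum_image (fun _ _ _ _ hij => h.inj hij)]
    simp only [hρ]
  rw [key P σ h.left, key Q τ h.right]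
  have : ∑ z ∈ (Finset.univ.image t)ᶜ, (if z.1 = u ∧ (Q.1 z).1 = v then 1 else 0) =
      ∑ z ∈ (Finset.univ.image t)ᶜ, (if z.1 = u ∧ (P.1 z).1 = v then 1 else 0) := by
    refine Finset.sum_congr rfl fun z hz => ?_
    rw [h.rest z]
    intro i hi
    simp only [Finset.mem_compl, Finset.mem_image, Finset.mem_univ, true_and] at hz
    exact hz ⟨i, hi.symm⟩
  rw [this]
  ring

end Basics

/-! ### Loop-switchings: their effect on loops and double pairs, and their construction in both
directions. -/

section LoopSwitchings

variable {n : ℕ} {k : Fin n → ℕ}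

/-- The pairing of the six points of a loop-switching before the switching. -/
def loopOld : Fin 6 → Fin 6 := ![1, 0, 3, 2, 5, 4]

/-- The pairing of the six points of a loop-switching after the switching. -/
def loopNew : Fin 6 → Fin 6 := ![4, 2, 1, 5, 0, 3]

theorem partner_eq {P : Configuration k} {p q : Point k} (h : P.1 p = q) : P.1 q = p := by
  rw [← h, P.2.1]

theorem loop_tuple_injective {s : Fin 6 → Point k} (h23 : s 2 ≠ s 3) (hc : (s 2).1 = (s 3).1)
    (hd : [(s 0).1, (s 1).1, (s 2).1, (s 4).1, (s 5).1].Nodup) : Function.Injective s := by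
  simp only [List.nodup_cons, List.mem_cons, List.not_mem_nil, or_false, not_or] at hd
  obtain ⟨⟨h1, h2, h3, h4⟩, ⟨h5, h6, h7⟩, ⟨h8, h9⟩, h10, -⟩ := hd
  have e : ∀ {i j : Fin 6}, s i = s j → (s i).1 = (s j).1 := fun h => congrArg Sigma.fst h
  intro i j hij
  have hij' := e hij
  fin_cases i <;> fin_cases j <;> simp_all

theorem IsLoopSwitching.rewired {P Q : Configuration k} {s : Fin 6 → Point k}
    (h : IsLoopSwitching P Q s) : Rewired P Q s loopOld loopNew where
  inj := loop_tuple_injective (fun h' => P.2.2 (s 2) (h.pair_xy.trans h'.symm)) h.same_cell h.cells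
  left i := by
    fin_cases i
    exacts [h.pair_ab, partner_eq h.pair_ab, h.pair_xy, partner_eq h.pair_xy, h.pair_cd,
      partner_eq h.pair_cd]
  right i := by
    fin_cases i
    exacts [h.result_ac, h.result_bx, partner_eq h.result_bx, h.result_yd, partner_eq h.result_ac,
      partner_eq h.result_yd]
  rest := h.rest

/-- The multiplicities of the pairs of cells around the 5-cycle of a loop-switching. -/
theorem loop_mult_eq {P Q : Configuration k} {s : Fin 6 → Point k}
    (h : Rewired P Q s loopOld loopNew) (hc : (s 2).1 = (s 3).1)
    (hd : [(s 0).1, (s 1).1, (s 2).1, (s 4).1, (s 5).1].Nodup) :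
    mult P (s 0).1 (s 1).1 = mult Q (s 0).1 (s 1).1 + 1 ∧
    mult P (s 4).1 (s 5).1 = mult Q (s 4).1 (s 5).1 + 1 ∧
    mult Q (s 0).1 (s 4).1 = mult P (s 0).1 (s 4).1 + 1 ∧
    mult Q (s 1).1 (s 2).1 = mult P (s 1).1 (s 2).1 + 1 ∧
    mult Q (s 3).1 (s 5).1 = mult P (s 3).1 (s 5).1 + 1 ∧
    mult P (s 2).1 (s 2).1 = mult Q (s 2).1 (s 2).1 + 2 ∧
    (∀ v, v ≠ (s 2).1 → mult P v v = mult Q v v) ∧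
    ∀ u v, u ≠ v → mult P u v = mult Q u v ∨
      (u = (s 0).1 ∧ v = (s 1).1 ∨ u = (s 4).1 ∧ v = (s 5).1 ∨ u = (s 0).1 ∧ v = (s 4).1 ∨
        u = (s 1).1 ∧ v = (s 2).1 ∨ u = (s 3).1 ∧ v = (s 5).1) ∨
      (v = (s 0).1 ∧ u = (s 1).1 ∨ v = (s 4).1 ∧ u = (s 5).1 ∨ v = (s 0).1 ∧ u = (s 4).1 ∨
        v = (s 1).1 ∧ u = (s 2).1 ∨ v = (s 3).1 ∧ u = (s 5).1) := by
  -- Each clause is this balance at one pair of cells, where distinctness of the cells decides every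
  -- indicator. At the cell of the loop both points of the loop contribute, hence the difference 2.
  have key := h.mult_eq
  simp only [Fin.sum_univ_six] at key
  simp only [loopOld, loopNew, Matrix.cons_val] at key
  rw [← hc] at key ⊢
  generalize (s 0).1 = A at *
  generalize (s 1).1 = B at *
  generalize (s 2).1 = X at *
  generalize (s 4).1 = C at *
  generalize (s 5).1 = D at *
  clear h hc
  simp only [List.nodup_cons, List.mem_cons, List.not_mem_nil, or_false, not_or] at hd
  obtain ⟨⟨h1, h2, h3, h4⟩, ⟨h5, h6, h7⟩, ⟨h8, h9⟩, h10, -⟩ := hd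
  have e1 := Ne.symm h1
  have e2 := Ne.symm h2
  have e3 := Ne.symm h3
  have e4 := Ne.symm h4
  have e5 := Ne.symm h5
  have e6 := Ne.symm h6
  have e7 := Ne.symm h7
  have e8 := Ne.symm h8
  have e9 := Ne.symm h9
  have e10 := Ne.symm h10
  refine ⟨?_, ?_, ?_, ?_, ?_, ?_, ?_, ?_⟩
  · simpa [arcInd, *] using key A B
  · simpa [arcInd, *] using key C D
  · simpa [arcInd, *] using (key A C).symm
  · simpa [arcInd, *] using (key B X).symm
  · simpa [arcInd, *] using (key X D).symm
  · simpa [arcInd, *] using key X X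
  · intro v hv
    have hz : ∀ a b, a ≠ b → arcInd a b v v = 0 := by
      rintro a b hab
      simp only [arcInd, ite_eq_right_iff, one_ne_zero, imp_false, not_and]
      rintro rfl rfl
      exact hab rfl
    have := key v v
    rwa [hz A C h3, hz B X h5, hz X B e5, hz X D h9, hz C A e3, hz D X e9, hz A B h1, hz B A e1,
      hz C D h10, hz D C e10, arcInd_eq_zero_left hv.symm] at this
  · intro u v huv
    have hz : ∀ a b, ¬ (u = a ∧ v = b) → arcInd a b u v = 0 := by
      intro a b hab
      simp only [arcInd, ite_eq_right_iff, one_ne_zero, imp_false]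
      exact fun h => hab ⟨h.1.symm, h.2.symm⟩
    by_contra hcon
    simp only [not_or] at hcon
    obtain ⟨h0, ⟨c1, c2, c3, c4, c5⟩, d1, d2, d3, d4, d5⟩ := hcon
    rw [and_comm] at d1 d2 d3 d4 d5
    have := key u v
    rw [hz _ _ c1, hz _ _ c2, hz _ _ c3, hz _ _ c4, hz _ _ c5, hz _ _ d1, hz _ _ d2, hz _ _ d3,
      hz _ _ d4, hz _ _ d5, hz X X (fun h => huv (h.1.trans h.2.symm))] at this
    exact h0 this

/-- The effect of a loop-switching on the multiplicities. -/
theorem loop_effect {P Q : Configuration k} {s : Fin 6 → Point k}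
    (h : Rewired P Q s loopOld loopNew) (hc : (s 2).1 = (s 3).1)
    (hd : [(s 0).1, (s 1).1, (s 2).1, (s 4).1, (s 5).1].Nodup)
    (hab : mult P (s 0).1 (s 1).1 = 1) (hcd : mult P (s 4).1 (s 5).1 = 1)
    (hac : mult P (s 0).1 (s 4).1 = 0) (hbx : mult P (s 1).1 (s 2).1 = 0)
    (hyd : mult P (s 3).1 (s 5).1 = 0) :
    numLoops P = numLoops Q + 1 ∧ (∀ v, v ≠ (s 2).1 → loopsAt P v = loopsAt Q v) ∧
      loopsAt P (s 2).1 = loopsAt Q (s 2).1 + 1 ∧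
      ∀ u v, u ≠ v → mult P u v = mult Q u v ∨ (mult P u v ≤ 1 ∧ mult Q u v ≤ 1) := by
  obtain ⟨e1, e2, e3, e4, e5, e6, e7, e8⟩ := loop_mult_eq h hc hd
  have l1 : ∀ v, v ≠ (s 2).1 → loopsAt P v = loopsAt Q v := fun v hv => by
    rw [loopsAt, e7 v hv, loopsAt]
  have l2 : loopsAt P (s 2).1 = loopsAt Q (s 2).1 + 1 := by
    rw [loopsAt, e6, loopsAt, Nat.add_div_right _ two_pos]
  refine ⟨?_, l1, l2, ?_⟩
  · rw [numLoops, numLoops, ← Finset.add_sum_erase _ _ (Finset.mem_univ (s 2).1),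
      ← Finset.add_sum_erase _ (fun v => loopsAt Q v) (Finset.mem_univ (s 2).1), l2,
      Finset.sum_congr rfl fun v hv => l1 v (Finset.ne_of_mem_erase hv)]
    ring
  · intro u v huv
    refine (e8 u v huv).imp_right fun h' => ?_
    rcases h' with (⟨rfl, rfl⟩ | ⟨rfl, rfl⟩ | ⟨rfl, rfl⟩ | ⟨rfl, rfl⟩ | ⟨rfl, rfl⟩) |
      ⟨rfl, rfl⟩ | ⟨rfl, rfl⟩ | ⟨rfl, rfl⟩ | ⟨rfl, rfl⟩ | ⟨rfl, rfl⟩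
    any_goals omega
    -- The remaining cases are the same pairs of cells read in the opposite order.
    all_goals
      rw [mult_comm P, mult_comm Q]
      omega

/-- The binomial coefficient (m choose 2) does not distinguish m = 0 from m = 1, so only
multiplicities of at least 2 matter. -/
theorem numDoubles_congr {P Q : Configuration k}
    (h : ∀ u v, u ≠ v → mult P u v = mult Q u v ∨ (mult P u v ≤ 1 ∧ mult Q u v ≤ 1)) :
    numDoubles P = numDoubles Q := by
  refine Finset.sum_congr rfl fun u _ => Finset.sum_congr rfl fun v hv => ?_
  rcases h u v (Finset.mem_filter.1 hv).2.ne with h1 | ⟨h1, h2⟩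
  · rw [h1]
  · rw [Nat.choose_eq_zero_of_lt (by omega), Nat.choose_eq_zero_of_lt (by omega)]

theorem IsLoopSwitching.effect {P Q : Configuration k} {s : Fin 6 → Point k}
    (h : IsLoopSwitching P Q s) :
    numLoops P = numLoops Q + 1 ∧ numDoubles P = numDoubles Q ∧ IsGood Q := by
  obtain ⟨h1, h2, h3, h4⟩ := loop_effect h.rewired h.same_cell h.cells h.single_ab h.single_cd
    h.new_ac h.new_bx h.new_yd
  have h5 := numDoubles_congr h4
  refine ⟨h1, h5, ?_, ?_, ?_, ?_⟩
  · intro v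
    have := h.good.loopsAt_le_one v
    by_cases hv : v = (s 2).1
    · subst hv; omega
    · rwa [← h2 v hv]
  · intro u v huv
    have := h.good.no_triple u v huv
    rcases h4 u v huv with h6 | h6 <;> omega
  · refine le_trans ?_ h.good.numLoops_le
    rw [h1]; push_cast; linarith
  · rw [← h5]; exact h.good.numDoubles_le

/-- A loop-switching of a given configuration. -/
theorem exists_loopSwitching_from {P : Configuration k} (hP : IsGood P) {s : Fin 6 → Point k}
    (pair_ab : P.1 (s 0) = s 1) (pair_xy : P.1 (s 2) = s 3) (pair_cd : P.1 (s 4) = s 5)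
    (same_cell : (s 2).1 = (s 3).1)
    (cells : [(s 0).1, (s 1).1, (s 2).1, (s 4).1, (s 5).1].Nodup)
    (single_ab : mult P (s 0).1 (s 1).1 = 1) (single_cd : mult P (s 4).1 (s 5).1 = 1)
    (new_ac : mult P (s 0).1 (s 4).1 = 0) (new_bx : mult P (s 1).1 (s 2).1 = 0)
    (new_yd : mult P (s 3).1 (s 5).1 = 0) : ∃ Q, IsLoopSwitching P Q s := by
  obtain ⟨Q, hQ⟩ := exists_rewired P s loopOld loopNew
    (loop_tuple_injective (fun h' => P.2.2 (s 2) (pair_xy.trans h'.symm)) same_cell cells)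
    (fun i => by
      fin_cases i
      exacts [pair_ab, partner_eq pair_ab, pair_xy, partner_eq pair_xy, pair_cd,
        partner_eq pair_cd]) (by decide) (by decide)
  exact ⟨Q, hP, pair_ab, pair_xy, pair_cd, same_cell, cells, single_ab, single_cd, new_ac, new_bx,
    new_yd, hQ.right 0, hQ.right 1, hQ.right 3, hQ.rest⟩

/-- A loop-switching which produces a given configuration. -/
theorem exists_loopSwitching_to {Q : Configuration k} (hQ : IsGood Q)
    (hl : (numLoops Q : ℝ) + 1 ≤ loopCap k) {s : Fin 6 → Point k}
    (pair_ac : Q.1 (s 0) = s 4) (pair_bx : Q.1 (s 1) = s 2) (pair_yd : Q.1 (s 3) = s 5)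
    (x_ne_y : s 2 ≠ s 3) (same_cell : (s 2).1 = (s 3).1)
    (cells : [(s 0).1, (s 1).1, (s 2).1, (s 4).1, (s 5).1].Nodup)
    (no_loop : mult Q (s 2).1 (s 2).1 = 0)
    (ac : mult Q (s 0).1 (s 4).1 = 1) (bx : mult Q (s 1).1 (s 2).1 = 1)
    (yd : mult Q (s 3).1 (s 5).1 = 1)
    (ab : mult Q (s 0).1 (s 1).1 = 0) (cd : mult Q (s 4).1 (s 5).1 = 0) :
    ∃ P, IsLoopSwitching P Q s := by
  obtain ⟨P, hP⟩ := exists_rewired Q s loopNew loopOld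
    (loop_tuple_injective x_ne_y same_cell cells)
    (fun i => by
      fin_cases i
      exacts [pair_ac, pair_bx, partner_eq pair_bx, pair_yd, partner_eq pair_ac,
        partner_eq pair_yd]) (by decide) (by decide)
  obtain ⟨e1, e2, e3, e4, e5, -⟩ := loop_mult_eq hP.symm same_cell cells
  have f1 : mult P (s 0).1 (s 1).1 = 1 := by omega
  have f2 : mult P (s 4).1 (s 5).1 = 1 := by omega
  have f3 : mult P (s 0).1 (s 4).1 = 0 := by omega
  have f4 : mult P (s 1).1 (s 2).1 = 0 := by omega
  have f5 : mult P (s 3).1 (s 5).1 = 0 := by omega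
  obtain ⟨h1, h2, h3, h4⟩ := loop_effect hP.symm same_cell cells f1 f2 f3 f4 f5
  have h5 := numDoubles_congr h4
  refine ⟨P, ⟨?_, ?_, ?_, ?_⟩, hP.right 0, hP.right 2, hP.right 4, same_cell, cells, f1, f2, f3, f4,
    f5, pair_ac, pair_bx, pair_yd, fun z hz => (hP.rest z hz).symm⟩
  · intro v
    have := hQ.loopsAt_le_one v
    by_cases hv : v = (s 2).1
    -- The cell that receives the loop must be loop-free in `Q`, so that it has exactly one loop in
    -- `P`.
    · subst hv; rw [h3, loopsAt, no_loop]
    · rwa [h2 v hv]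
  · intro u v huv
    have := hQ.no_triple u v huv
    rcases h4 u v huv with h6 | h6 <;> omega
  -- `P` has one loop more than `Q`, and `hl` keeps it below the cap B₁.
  · rw [h1]; push_cast; exact hl
  · rw [h5]; exact hQ.numDoubles_le

end LoopSwitchings

/-! ### Double-switchings: their effect on loops and double pairs, and their construction in both
directions. -/

section DoubleSwitchings

variable {n : ℕ} {k : Fin n → ℕ}

/-- The pairing of the eight points of a double-switching before the switching. -/
def doubleOld : Fin 8 → Fin 8 := ![4, 5, 6, 7, 0, 1, 2, 3]

/-- The pairing of the eight points of a double-switching after the switching. -/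
def doubleNew : Fin 8 → Fin 8 := ![1, 0, 3, 2, 5, 4, 7, 6]

theorem double_tuple_injective {s : Fin 8 → Point k} (h12 : s 1 ≠ s 2) (h56 : s 5 ≠ s 6)
    (hc : (s 1).1 = (s 2).1) (hc' : (s 5).1 = (s 6).1)
    (hd : [(s 0).1, (s 1).1, (s 3).1, (s 4).1, (s 5).1, (s 7).1].Nodup) :
    Function.Injective s := by
  simp only [List.nodup_cons, List.mem_cons, List.not_mem_nil, or_false, not_or] at hd
  obtain ⟨⟨h1, h2, h3, h4, h5⟩, ⟨h6, h7, h8, h9⟩, ⟨h10, h11, h12⟩, ⟨h13, h14⟩, h15, -⟩ := hd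
  have e : ∀ {i j : Fin 8}, s i = s j → (s i).1 = (s j).1 := fun h => congrArg Sigma.fst h
  intro i j hij
  have hij' := e hij
  fin_cases i <;> fin_cases j <;> simp_all

theorem IsDoubleSwitching.rewired {P Q : Configuration k} {s : Fin 8 → Point k}
    (h : IsDoubleSwitching P Q s) : Rewired P Q s doubleOld doubleNew where
  inj := double_tuple_injective h.b_ne_c
    (fun h' => h.b_ne_c (P.injective (h.pair_bf.trans (h'.trans h.pair_cg.symm))))
    h.same_cell_bc h.same_cell_fg h.cells
  left i := by
    fin_cases i
    exacts [h.pair_ae, h.pair_bf, h.pair_cg, h.pair_dh, partner_eq h.pair_ae,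
      partner_eq h.pair_bf, partner_eq h.pair_cg, partner_eq h.pair_dh]
  right i := by
    fin_cases i
    exacts [h.result_ab, partner_eq h.result_ab, h.result_cd, partner_eq h.result_cd,
      h.result_ef, partner_eq h.result_ef, h.result_gh, partner_eq h.result_gh]
  rest := h.rest

/-- The multiplicities of the pairs of cells in a double-switching. -/
theorem double_mult_eq {P Q : Configuration k} {s : Fin 8 → Point k}
    (h : Rewired P Q s doubleOld doubleNew) (hc : (s 1).1 = (s 2).1) (hc' : (s 5).1 = (s 6).1)
    (hd : [(s 0).1, (s 1).1, (s 3).1, (s 4).1, (s 5).1, (s 7).1].Nodup) :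
    mult P (s 0).1 (s 4).1 = mult Q (s 0).1 (s 4).1 + 1 ∧
    mult P (s 3).1 (s 7).1 = mult Q (s 3).1 (s 7).1 + 1 ∧
    mult P (s 1).1 (s 5).1 = mult Q (s 1).1 (s 5).1 + 2 ∧
    mult Q (s 0).1 (s 1).1 = mult P (s 0).1 (s 1).1 + 1 ∧
    mult Q (s 2).1 (s 3).1 = mult P (s 2).1 (s 3).1 + 1 ∧
    mult Q (s 4).1 (s 5).1 = mult P (s 4).1 (s 5).1 + 1 ∧
    mult Q (s 6).1 (s 7).1 = mult P (s 6).1 (s 7).1 + 1 ∧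
    (∀ v, mult P v v = mult Q v v) ∧
    ∀ u v, u ≠ v → ¬ (u = (s 1).1 ∧ v = (s 5).1) → ¬ (v = (s 1).1 ∧ u = (s 5).1) →
      mult P u v = mult Q u v ∨
      (u = (s 0).1 ∧ v = (s 4).1 ∨ u = (s 3).1 ∧ v = (s 7).1 ∨ u = (s 0).1 ∧ v = (s 1).1 ∨ u = (s 2).1 ∧ v = (s 3).1 ∨ u = (s 4).1 ∧ v = (s 5).1 ∨ u = (s 6).1 ∧ v = (s 7).1) ∨
      (v = (s 0).1 ∧ u = (s 4).1 ∨ v = (s 3).1 ∧ u = (s 7).1 ∨ v = (s 0).1 ∧ u = (s 1).1 ∨ v = (s 2).1 ∧ u = (s 3).1 ∨ v = (s 4).1 ∧ u = (s 5).1 ∨ v = (s 6).1 ∧ u = (s 7).1) := by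
  -- Again a balance at one pair of cells for each clause. The removed pairs `bf` and `cg` join the
  -- same two cells, hence the difference 2 there.
  have key := h.mult_eq
  simp only [Fin.sum_univ_eight] at key
  simp only [doubleOld, doubleNew, Matrix.cons_val] at key
  rw [← hc, ← hc'] at key ⊢
  generalize (s 0).1 = A at *
  generalize (s 1).1 = U at *
  generalize (s 3).1 = D at *
  generalize (s 4).1 = E at *
  generalize (s 5).1 = W at *
  generalize (s 7).1 = H at *
  clear h hc hc'
  simp only [List.nodup_cons, List.mem_cons, List.not_mem_nil, or_false, not_or] at hd
  obtain ⟨⟨h1, h2, h3, h4, h5⟩, ⟨h6, h7, h8, h9⟩, ⟨h10, h11, h12⟩, ⟨h13, h14⟩, h15, -⟩ := hd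
  have e1 := Ne.symm h1
  have e2 := Ne.symm h2
  have e3 := Ne.symm h3
  have e4 := Ne.symm h4
  have e5 := Ne.symm h5
  have e6 := Ne.symm h6
  have e7 := Ne.symm h7
  have e8 := Ne.symm h8
  have e9 := Ne.symm h9
  have e10 := Ne.symm h10
  have e11 := Ne.symm h11
  have e12 := Ne.symm h12
  have e13 := Ne.symm h13
  have e14 := Ne.symm h14
  have e15 := Ne.symm h15
  refine ⟨?_, ?_, ?_, ?_, ?_, ?_, ?_, ?_, ?_⟩
  · simpa [arcInd, *] using key A E
  · simpa [arcInd, *] using key D H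
  · simpa [arcInd, *] using key U W
  · simpa [arcInd, *] using (key A U).symm
  · simpa [arcInd, *] using (key U D).symm
  · simpa [arcInd, *] using (key E W).symm
  · simpa [arcInd, *] using (key W H).symm
  · intro v
    have hz : ∀ a b, a ≠ b → arcInd a b v v = 0 := by
      rintro a b hab
      simp only [arcInd, ite_eq_right_iff, one_ne_zero, imp_false, not_and]
      rintro rfl rfl
      exact hab rfl
    have := key v v
    rwa [hz A E h3, hz E A e3, hz U W h8, hz W U e8, hz D H h12,
      hz H D e12, hz A U h1, hz U A e1, hz U D h6, hz D U e6,
      hz E W h13, hz W E e13, hz W H h15, hz H W e15] at this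
  · intro u v huv huw hwu
    have hz : ∀ a b, ¬ (u = a ∧ v = b) → arcInd a b u v = 0 := by
      intro a b hab
      simp only [arcInd, ite_eq_right_iff, one_ne_zero, imp_false]
      exact fun h => hab ⟨h.1.symm, h.2.symm⟩
    by_contra hcon
    simp only [not_or] at hcon
    obtain ⟨h0, ⟨c1, c2, c3, c4, c5, c6⟩, d1, d2, d3, d4, d5, d6⟩ := hcon
    rw [and_comm] at d1 d2 d3 d4 d5 d6 hwu
    have := key u v
    rw [hz _ _ c1, hz _ _ c2, hz _ _ c3, hz _ _ c4, hz _ _ c5, hz _ _ c6, hz _ _ d1, hz _ _ d2,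
      hz _ _ d3, hz _ _ d4, hz _ _ d5, hz _ _ d6, hz _ _ huw, hz _ _ hwu] at this
    exact h0 this

theorem numLoops_congr {P Q : Configuration k} (h : ∀ v, mult P v v = mult Q v v) :
    numLoops P = numLoops Q := by
  simp only [numLoops, loopsAt, h]

/-- The cells `U`, `W` contribute (2 choose 2) = 1 before and 0 after, and every other change stays
within multiplicities 0 and 1. The symmetric hypotheses allow `U < W` to be assumed, the order used
in `numDoubles`. -/
theorem numDoubles_succ {P Q : Configuration k} {U W : Fin n} (hUW : U ≠ W)
    (h2 : mult P U W = 2) (h0 : mult Q U W = 0)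
    (h : ∀ u v, u ≠ v → ¬ (u = U ∧ v = W) → ¬ (v = U ∧ u = W) →
      mult P u v = mult Q u v ∨ (mult P u v ≤ 1 ∧ mult Q u v ≤ 1)) :
    numDoubles P = numDoubles Q + 1 := by
  wlog hlt : U < W generalizing U W
  · exact this hUW.symm (by rwa [mult_comm]) (by rwa [mult_comm])
      (fun u v huv h3 h4 => h u v huv (fun h5 => h4 h5.symm) (fun h5 => h3 h5.symm))
      (lt_of_le_of_ne (not_lt.1 hlt) hUW.symm)
  have key : ∀ R : Configuration k, numDoubles R =
      ∑ p ∈ Finset.univ.filter (fun p : Fin n × Fin n => p.1 < p.2), (mult R p.1 p.2).choose 2 := by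
    intro R
    simp only [numDoubles, Finset.sum_filter, Fintype.sum_prod_type]
  have hmem : (U, W) ∈ Finset.univ.filter (fun p : Fin n × Fin n => p.1 < p.2) := by simpa
  rw [key P, key Q, ← Finset.add_sum_erase _ _ hmem,
    ← Finset.add_sum_erase _ (fun p : Fin n × Fin n => (mult Q p.1 p.2).choose 2) hmem, h2, h0]
  have : ∀ p ∈ (Finset.univ.filter (fun p : Fin n × Fin n => p.1 < p.2)).erase (U, W),
      (mult P p.1 p.2).choose 2 = (mult Q p.1 p.2).choose 2 := by
    rintro ⟨u, v⟩ hp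
    simp only [Finset.mem_erase, Finset.mem_filter, Finset.mem_univ, true_and, ne_eq,
      Prod.mk.injEq] at hp
    rcases h u v hp.2.ne hp.1 (by rintro ⟨rfl, rfl⟩; exact lt_asymm hp.2 hlt) with h1 | ⟨h1, h2⟩
    · rw [h1]
    · rw [Nat.choose_eq_zero_of_lt (show mult P u v < 2 by omega),
        Nat.choose_eq_zero_of_lt (show mult Q u v < 2 by omega)]
  rw [Finset.sum_congr rfl this]
  simp [add_comm]

/-- The effect of a double-switching on the multiplicities. -/
theorem double_effect {P Q : Configuration k} {s : Fin 8 → Point k}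
    (h : Rewired P Q s doubleOld doubleNew) (hc : (s 1).1 = (s 2).1) (hc' : (s 5).1 = (s 6).1)
    (hd : [(s 0).1, (s 1).1, (s 3).1, (s 4).1, (s 5).1, (s 7).1].Nodup)
    (hae : mult P (s 0).1 (s 4).1 = 1) (hdh : mult P (s 3).1 (s 7).1 = 1)
    (hbf : mult P (s 1).1 (s 5).1 = 2)
    (hab : mult P (s 0).1 (s 1).1 = 0) (hcd : mult P (s 2).1 (s 3).1 = 0)
    (hef : mult P (s 4).1 (s 5).1 = 0) (hgh : mult P (s 6).1 (s 7).1 = 0) :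
    numDoubles P = numDoubles Q + 1 ∧ (∀ v, mult P v v = mult Q v v) ∧
      ∀ u v, u ≠ v → mult P u v = mult Q u v ∨ (mult P u v ≤ 2 ∧ mult Q u v ≤ 2) := by
  obtain ⟨e1, e2, e3, e4, e5, e6, e7, e8, e9⟩ := double_mult_eq h hc hc' hd
  have key : ∀ u v, u ≠ v → ¬ (u = (s 1).1 ∧ v = (s 5).1) → ¬ (v = (s 1).1 ∧ u = (s 5).1) →
      mult P u v = mult Q u v ∨ (mult P u v ≤ 1 ∧ mult Q u v ≤ 1) := by
    intro u v huv huw hwu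
    refine (e9 u v huv huw hwu).imp_right fun h' => ?_
    rcases h' with (⟨rfl, rfl⟩ | ⟨rfl, rfl⟩ | ⟨rfl, rfl⟩ | ⟨rfl, rfl⟩ | ⟨rfl, rfl⟩ | ⟨rfl, rfl⟩) |
      ⟨rfl, rfl⟩ | ⟨rfl, rfl⟩ | ⟨rfl, rfl⟩ | ⟨rfl, rfl⟩ | ⟨rfl, rfl⟩ | ⟨rfl, rfl⟩
    any_goals omega
    all_goals
      rw [mult_comm P, mult_comm Q]
      omega
  have hne : (s 1).1 ≠ (s 5).1 := by
    simp only [List.nodup_cons, List.mem_cons, not_or] at hd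
    exact hd.2.1.2.2.1
  refine ⟨numDoubles_succ hne hbf (by omega) key, e8, ?_⟩
  intro u v huv
  by_cases h1 : u = (s 1).1 ∧ v = (s 5).1
  · obtain ⟨rfl, rfl⟩ := h1
    omega
  by_cases h2 : v = (s 1).1 ∧ u = (s 5).1
  · obtain ⟨rfl, rfl⟩ := h2
    rw [mult_comm P, mult_comm Q]
    omega
  rcases key u v huv h1 h2 with h3 | h3
  · exact Or.inl h3
  · omega

/-- Two pairs between these cells are removed, so the multiplicity is at least 2; goodness excludes
3. -/
theorem IsDoubleSwitching.mult_double {P Q : Configuration k} {s : Fin 8 → Point k}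
    (h : IsDoubleSwitching P Q s) : mult P (s 1).1 (s 5).1 = 2 := by
  obtain ⟨-, -, e3, -⟩ := double_mult_eq h.rewired h.same_cell_bc h.same_cell_fg h.cells
  have hne : (s 1).1 ≠ (s 5).1 := by
    have hd := h.cells
    simp only [List.nodup_cons, List.mem_cons, not_or] at hd
    exact hd.2.1.2.2.1
  have := h.good.no_triple _ _ hne
  omega

theorem IsDoubleSwitching.effect {P Q : Configuration k} {s : Fin 8 → Point k}
    (h : IsDoubleSwitching P Q s) :
    numLoops P = numLoops Q ∧ numDoubles P = numDoubles Q + 1 ∧ IsGood Q := by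
  obtain ⟨h1, h2, h3⟩ := double_effect h.rewired h.same_cell_bc h.same_cell_fg h.cells h.single_ae
    h.single_dh h.mult_double h.new_ab h.new_cd h.new_ef h.new_gh
  have h5 := numLoops_congr h2
  refine ⟨h5, h1, ?_, ?_, ?_, ?_⟩
  · intro v
    rw [loopsAt, ← h2]
    exact h.good.loopsAt_le_one v
  · intro u v huv
    have := h.good.no_triple u v huv
    rcases h3 u v huv with h6 | h6 <;> omega
  · rw [← h5]; exact h.good.numLoops_le
  · refine le_trans ?_ h.good.numDoubles_le
    rw [h1]; push_cast; linarith

/-- A double-switching of a given configuration. -/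
theorem exists_doubleSwitching_from {P : Configuration k} (hP : IsGood P) {s : Fin 8 → Point k}
    (pair_ae : P.1 (s 0) = s 4) (pair_bf : P.1 (s 1) = s 5) (pair_cg : P.1 (s 2) = s 6)
    (pair_dh : P.1 (s 3) = s 7) (b_ne_c : s 1 ≠ s 2)
    (same_cell_bc : (s 1).1 = (s 2).1) (same_cell_fg : (s 5).1 = (s 6).1)
    (cells : [(s 0).1, (s 1).1, (s 3).1, (s 4).1, (s 5).1, (s 7).1].Nodup)
    (single_ae : mult P (s 0).1 (s 4).1 = 1) (single_dh : mult P (s 3).1 (s 7).1 = 1)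
    (new_ab : mult P (s 0).1 (s 1).1 = 0) (new_cd : mult P (s 2).1 (s 3).1 = 0)
    (new_ef : mult P (s 4).1 (s 5).1 = 0) (new_gh : mult P (s 6).1 (s 7).1 = 0) :
    ∃ Q, IsDoubleSwitching P Q s := by
  obtain ⟨Q, hQ⟩ := exists_rewired P s doubleOld doubleNew
    (double_tuple_injective b_ne_c
      (fun h' => b_ne_c (P.injective (pair_bf.trans (h'.trans pair_cg.symm))))
      same_cell_bc same_cell_fg cells)
    (fun i => by
      fin_cases i
      exacts [pair_ae, pair_bf, pair_cg, pair_dh, partner_eq pair_ae, partner_eq pair_bf,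
        partner_eq pair_cg, partner_eq pair_dh]) (by decide) (by decide)
  exact ⟨Q, hP, pair_ae, pair_bf, pair_cg, pair_dh, b_ne_c, same_cell_bc, same_cell_fg, cells,
    single_ae, single_dh, new_ab, new_cd, new_ef, new_gh, hQ.right 0, hQ.right 2, hQ.right 4,
    hQ.right 6, hQ.rest⟩

/-- A double-switching which produces a given configuration. -/
theorem exists_doubleSwitching_to {Q : Configuration k} (hQ : IsGood Q)
    (hd : (numDoubles Q : ℝ) + 1 ≤ doubleCap k) {s : Fin 8 → Point k}
    (pair_ab : Q.1 (s 0) = s 1) (pair_cd : Q.1 (s 2) = s 3) (pair_ef : Q.1 (s 4) = s 5)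
    (pair_gh : Q.1 (s 6) = s 7) (b_ne_c : s 1 ≠ s 2) (f_ne_g : s 5 ≠ s 6)
    (same_cell_bc : (s 1).1 = (s 2).1) (same_cell_fg : (s 5).1 = (s 6).1)
    (cells : [(s 0).1, (s 1).1, (s 3).1, (s 4).1, (s 5).1, (s 7).1].Nodup)
    (ab : mult Q (s 0).1 (s 1).1 = 1) (cd : mult Q (s 2).1 (s 3).1 = 1)
    (ef : mult Q (s 4).1 (s 5).1 = 1) (gh : mult Q (s 6).1 (s 7).1 = 1)
    (ae : mult Q (s 0).1 (s 4).1 = 0) (dh : mult Q (s 3).1 (s 7).1 = 0)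
    (bf : mult Q (s 1).1 (s 5).1 = 0) : ∃ P, IsDoubleSwitching P Q s := by
  obtain ⟨P, hP⟩ := exists_rewired Q s doubleNew doubleOld
    (double_tuple_injective b_ne_c f_ne_g same_cell_bc same_cell_fg cells)
    (fun i => by
      fin_cases i
      exacts [pair_ab, partner_eq pair_ab, pair_cd, partner_eq pair_cd, pair_ef,
        partner_eq pair_ef, pair_gh, partner_eq pair_gh]) (by decide) (by decide)
  obtain ⟨e1, e2, e3, e4, e5, e6, e7, -⟩ :=
    double_mult_eq hP.symm same_cell_bc same_cell_fg cells
  have f1 : mult P (s 0).1 (s 4).1 = 1 := by omega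
  have f2 : mult P (s 3).1 (s 7).1 = 1 := by omega
  have f3 : mult P (s 1).1 (s 5).1 = 2 := by omega
  have f4 : mult P (s 0).1 (s 1).1 = 0 := by omega
  have f5 : mult P (s 2).1 (s 3).1 = 0 := by omega
  have f6 : mult P (s 4).1 (s 5).1 = 0 := by omega
  have f7 : mult P (s 6).1 (s 7).1 = 0 := by omega
  obtain ⟨h1, h2, h3⟩ := double_effect hP.symm same_cell_bc same_cell_fg cells f1 f2 f3 f4 f5 f6 f7
  refine ⟨P, ⟨?_, ?_, ?_, ?_⟩, hP.right 0, hP.right 1, hP.right 2, hP.right 3, b_ne_c,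
    same_cell_bc, same_cell_fg, cells, f1, f2, f4, f5, f6, f7, pair_ab, pair_cd, pair_ef, pair_gh,
    fun z hz => (hP.rest z hz).symm⟩
  · intro v
    rw [loopsAt, h2]
    exact hQ.loopsAt_le_one v
  · intro u v huv
    have := hQ.no_triple u v huv
    rcases h3 u v huv with h6 | h6 <;> omega
  · rw [numLoops_congr h2]; exact hQ.numLoops_le
  · rw [h1]; push_cast; exact hd

end DoubleSwitchings

/-! ### Upper and lower bounds for the numbers of switchings. -/

section Counting

variable {n : ℕ} {k : Fin n → ℕ}

theorem card_filter_le_add {α : Type*} {S : Finset α} {p q r : α → Prop} [DecidablePred p]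
    [DecidablePred q] [DecidablePred r] (h : ∀ x ∈ S, p x → q x ∨ r x) :
    (S.filter p).card ≤ (S.filter q).card + (S.filter r).card := by
  classical
  refine le_trans (Finset.card_le_card ?_) (Finset.card_union_le _ _)
  intro x hx
  rw [Finset.mem_filter] at hx
  rw [Finset.mem_union, Finset.mem_filter, Finset.mem_filter]
  exact (h x hx.1 hx.2).imp (fun h => ⟨hx.1, h⟩) (fun h => ⟨hx.1, h⟩)

theorem card_le_filter_add {α : Type*} {S : Finset α} {q r : α → Prop}
    [DecidablePred q] [DecidablePred r] (h : ∀ x ∈ S, q x ∨ r x) :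
    S.card ≤ (S.filter q).card + (S.filter r).card := by
  have := card_filter_le_add (p := fun _ => True) (fun x hx _ => h x hx)
  rwa [Finset.filter_true] at this

/-- The form in which switchings that produce a configuration are counted from below: `x` is a first
choice of points, `y` a second choice depending on it, and `z` a switching from which both can be
read off. -/
theorem mul_le_card {α β γ : Type*} (S : Finset α) (A : α → Finset β) (B : Finset γ)
    (f : γ → α) (g : γ → β) (c : ℕ) (hA : ∀ x ∈ S, c ≤ (A x).card)
    (h : ∀ x ∈ S, ∀ y ∈ A x, ∃ z ∈ B, f z = x ∧ g z = y) : S.card * c ≤ B.card := by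
  calc S.card * c ≤ ∑ x ∈ S, (A x).card := by
        simpa using Finset.card_nsmul_le_sum S (fun x => (A x).card) c hA
    _ = (S.sigma A).card := (Finset.card_sigma _ _).symm
    _ ≤ B.card := by
        refine Finset.card_le_card_of_surjOn (fun z => (⟨f z, g z⟩ : Σ _ : α, β)) ?_
        rintro ⟨x, y⟩ hxy
        simp only [Finset.coe_sigma, Set.mem_sigma_iff, Finset.mem_coe] at hxy
        obtain ⟨z, hz, rfl, rfl⟩ := h x hxy.1 y hxy.2
        exact ⟨z, hz, rfl⟩

/-- This is (m - a)(x - b) ≤ N with the nonnegative term ab dropped. It stays true when `x < b`,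
where the left side is at most 0; hence `c` may be a truncated difference. -/
theorem product_lower_bound {s m c a b x N : ℕ} (hs : m ≤ s + a) (hc : x ≤ c + b)
    (hN : s * c ≤ N) : (m : ℝ) * x - a * x - b * m ≤ N := by
  have hs' : (m : ℝ) ≤ s + a := by exact_mod_cast hs
  have hc' : (x : ℝ) ≤ c + b := by exact_mod_cast hc
  have hN' : (s : ℝ) * c ≤ N := by exact_mod_cast hN
  have ha : (0 : ℝ) ≤ a := Nat.cast_nonneg a
  have hb : (0 : ℝ) ≤ b := Nat.cast_nonneg b
  have hm : (0 : ℝ) ≤ m := Nat.cast_nonneg m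
  have hx : (0 : ℝ) ≤ x := Nat.cast_nonneg x
  have hs0 : (0 : ℝ) ≤ s := Nat.cast_nonneg s
  have hc0 : (0 : ℝ) ≤ c := Nat.cast_nonneg c
  rcases le_total (x : ℝ) b with h | h
  · nlinarith [mul_nonneg hs0 hc0, mul_nonneg ha hx, mul_nonneg hm (sub_nonneg.2 h)]
  · have h1 : (s : ℝ) * (x - b) ≤ s * c := mul_le_mul_of_nonneg_left (by linarith) hs0
    have h2 : ((m : ℝ) - a) * (x - b) ≤ s * (x - b) :=
      mul_le_mul_of_nonneg_right (by linarith) (by linarith)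
    nlinarith [mul_nonneg ha hb]

/-- The points `p` such that the pair of `P` containing `p` is neither a loop nor in a double pair,
avoids the cells in `S`, and has `p` in a cell not joined to `w` and its partner in a cell not
joined to `w'`. -/
def available (P : Configuration k) (S : Finset (Fin n)) (w w' : Fin n) : Finset (Point k) :=
  Finset.univ.filter fun p => p.1 ≠ (P.1 p).1 ∧ p ∉ doublePoints P ∧ p.1 ∉ S ∧ (P.1 p).1 ∉ S ∧
    mult P w p.1 = 0 ∧ mult P w' (P.1 p).1 = 0

theorem mem_available {P : Configuration k} {S : Finset (Fin n)} {w w' : Fin n} {p : Point k} :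
    p ∈ available P S w w' ↔ p.1 ≠ (P.1 p).1 ∧ p ∉ doublePoints P ∧ p.1 ∉ S ∧ (P.1 p).1 ∉ S ∧
    mult P w p.1 = 0 ∧ mult P w' (P.1 p).1 = 0 := by simp [available]

/-- Union bound over the six ways to fail: 2ℓ points in loops, at most 4d in double pairs, at most
|S| k_max for the point and again for its partner to lie in `S`, and at most k_max² for each of the
two adjacency conditions. -/
theorem degSum_le_card_available (P : Configuration k) (S : Finset (Fin n)) (w w' : Fin n) :
    degSum k ≤ (available P S w w').card + (2 * numLoops P + 4 * numDoubles P +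
      2 * S.card * maxDeg k + 2 * maxDeg k ^ 2) := by
  classical
  rw [← card_point, ← Finset.card_univ]
  have h0 := card_le_filter_add (S := (Finset.univ : Finset (Point k)))
    (q := fun p => p.1 ≠ (P.1 p).1 ∧ p ∉ doublePoints P ∧ p.1 ∉ S ∧ (P.1 p).1 ∉ S ∧
      mult P w p.1 = 0 ∧ mult P w' (P.1 p).1 = 0)
    (r := fun p => p.1 = (P.1 p).1 ∨ p ∈ doublePoints P ∨ p.1 ∈ S ∨ (P.1 p).1 ∈ S ∨
      mult P w p.1 ≠ 0 ∨ mult P w' (P.1 p).1 ≠ 0) (fun p _ => by tauto)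
  have h1 := card_filter_le_add (S := (Finset.univ : Finset (Point k)))
    (p := fun p => p.1 = (P.1 p).1 ∨ p ∈ doublePoints P ∨ p.1 ∈ S ∨ (P.1 p).1 ∈ S ∨
      mult P w p.1 ≠ 0 ∨ mult P w' (P.1 p).1 ≠ 0) (fun p _ h => h)
  have h2 := card_filter_le_add (S := (Finset.univ : Finset (Point k)))
    (p := fun p => p ∈ doublePoints P ∨ p.1 ∈ S ∨ (P.1 p).1 ∈ S ∨
      mult P w p.1 ≠ 0 ∨ mult P w' (P.1 p).1 ≠ 0) (fun p _ h => h)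
  have h3 := card_filter_le_add (S := (Finset.univ : Finset (Point k)))
    (p := fun p => p.1 ∈ S ∨ (P.1 p).1 ∈ S ∨
      mult P w p.1 ≠ 0 ∨ mult P w' (P.1 p).1 ≠ 0) (fun p _ h => h)
  have h4 := card_filter_le_add (S := (Finset.univ : Finset (Point k)))
    (p := fun p => (P.1 p).1 ∈ S ∨
      mult P w p.1 ≠ 0 ∨ mult P w' (P.1 p).1 ≠ 0) (fun p _ h => h)
  have h5 := card_filter_le_add (S := (Finset.univ : Finset (Point k)))
    (p := fun p => mult P w p.1 ≠ 0 ∨ mult P w' (P.1 p).1 ≠ 0) (fun p _ h => h)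
  have b1 := card_loopPoints P
  have b2 := card_doublePoints_le P
  have b3 := card_mem_cells_le (k := k) S
  have b4 := card_filter_partner P (fun p => p.1 ∈ S)
  have b5 := card_linked_le P w
  have b6 := card_filter_partner P (fun p => mult P w' p.1 ≠ 0)
  have b7 := card_linked_le P w'
  rw [Finset.filter_univ_mem] at h2
  rw [loopPoints] at b1
  rw [available]
  have e : 2 * S.card * maxDeg k = S.card * maxDeg k + S.card * maxDeg k := by ring
  omega

theorem partner_cell_ne {P : Configuration k} {p q : Point k} (hpq : p ≠ q) (hc : p.1 = q.1)
    (hm : mult P p.1 (P.1 p).1 = 1) : (P.1 p).1 ≠ (P.1 q).1 := by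
  intro h
  have : 1 < mult P p.1 (P.1 p).1 :=
    Finset.one_lt_card.2 ⟨p, by simp, q, by simp [hc, h], hpq⟩
  omega

/-! ### Upper bounds for the numbers of switchings -/

/-- A loop-switching of `P` is determined by `x`, `a` and `c`: their partners are forced, and so is
the result. There are 2ℓ choices for `x` and M for each of the others. -/
theorem fLoop_le (P : Configuration k) : fLoop P ≤ upperLoop k (numLoops P) := by
  classical
  have : upperLoop k (numLoops P) =
      (loopPoints P ×ˢ (Finset.univ ×ˢ Finset.univ : Finset (Point k × Point k))).card := by
    rw [Finset.card_product, Finset.card_product, card_loopPoints, Finset.card_univ, card_point,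
      upperLoop, sq]
  rw [this, fLoop]
  refine Finset.card_le_card_of_injOn (fun x => (x.1 2, x.1 0, x.1 4)) ?_ ?_
  · rintro ⟨s, Q⟩ hx
    simp only [loopSwitchings, Finset.coe_filter, Finset.mem_univ, true_and, Set.mem_ofPred_eq] at hx
    simp [mem_loopPoints, hx.pair_xy, hx.same_cell]
  · rintro ⟨s, Q⟩ hx ⟨s', Q'⟩ hx' h
    simp only [loopSwitchings, Finset.coe_filter, Finset.mem_univ, true_and, Set.mem_ofPred_eq,
      Prod.mk.injEq] at hx hx' h
    obtain ⟨h2, h0, h4⟩ := h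
    have hs : s = s' := by
      funext i
      fin_cases i
      · exact h0
      · exact hx.pair_ab.symm.trans ((congrArg P.1 h0).trans hx'.pair_ab)
      · exact h2
      · exact hx.pair_xy.symm.trans ((congrArg P.1 h2).trans hx'.pair_xy)
      · exact h4
      · exact hx.pair_cd.symm.trans ((congrArg P.1 h4).trans hx'.pair_cd)
    subst hs
    rw [hx.rewired.unique hx'.rewired]

/-- A double-switching of `P` is determined by `b`, `a` and `d`, where `b` is one of the at most 4d
points in double pairs. -/
theorem fDouble_le (P : Configuration k) : fDouble P ≤ upperDouble k (numDoubles P) := by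
  classical
  have : (doublePoints P ×ˢ (Finset.univ ×ˢ Finset.univ : Finset (Point k × Point k))).card ≤
      upperDouble k (numDoubles P) := by
    rw [Finset.card_product, Finset.card_product, Finset.card_univ, card_point, upperDouble, sq]
    exact Nat.mul_le_mul_right _ (card_doublePoints_le P)
  refine le_trans ?_ this
  refine Finset.card_le_card_of_injOn (fun x => (x.1 1, x.1 0, x.1 3)) ?_ ?_
  · rintro ⟨s, Q⟩ hx
    simp only [doubleSwitchings, Finset.coe_filter, Finset.mem_univ, true_and,
      Set.mem_ofPred_eq] at hx
    have hne : (s 1).1 ≠ (s 5).1 := by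
      have hd := hx.cells
      simp only [List.nodup_cons, List.mem_cons, not_or] at hd
      exact hd.2.1.2.2.1
    simp [mem_doublePoints, hx.pair_bf, hx.mult_double, hne]
  · rintro ⟨s, Q⟩ hx ⟨s', Q'⟩ hx' h
    simp only [doubleSwitchings, Finset.coe_filter, Finset.mem_univ, true_and, Set.mem_ofPred_eq,
      Prod.mk.injEq] at hx hx' h
    obtain ⟨h1, h0, h3⟩ := h
    have h5 : s 5 = s' 5 := hx.pair_bf.symm.trans ((congrArg P.1 h1).trans hx'.pair_bf)
    -- The point `c` is forced as the other point of the double pair in the cell of `b`: a second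
    -- candidate would give a triple pair.
    have h2 : s 2 = s' 2 := by
      by_contra hne
      have : 2 < mult P (s 1).1 (s 5).1 := by
        refine Finset.two_lt_card.2 ⟨s 1, ?_, s 2, ?_, s' 2, ?_, hx.b_ne_c, ?_, hne⟩
        · simp [hx.pair_bf]
        · simp [hx.pair_cg, hx.same_cell_bc, hx.same_cell_fg]
        · simp [hx'.pair_cg, h1, h5, hx'.same_cell_bc, hx'.same_cell_fg]
        · rw [h1]; exact hx'.b_ne_c
      rw [hx.mult_double] at this
      omega
    have hs : s = s' := by
      funext i
      fin_cases i
      · exact h0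
      · exact h1
      · exact h2
      · exact h3
      · exact hx.pair_ae.symm.trans ((congrArg P.1 h0).trans hx'.pair_ae)
      · exact h5
      · exact hx.pair_cg.symm.trans ((congrArg P.1 h2).trans hx'.pair_cg)
      · exact hx.pair_dh.symm.trans ((congrArg P.1 h3).trans hx'.pair_dh)
    subst hs
    rw [hx.rewired.unique hx'.rewired]

/-! ### Existence of switchings -/

/-- Greedy choice: a loop point `x`, then `a` away from the cell of `x`, then `c` away from the
three cells in use. The last choice has the most exclusions, 2·3·k_max from cells, which is the 6
k_max in `hM`. -/
theorem fLoop_pos {P : Configuration k} (hP : IsGood P) (hl : 0 < numLoops P)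
    (hM : 2 * numLoops P + 4 * numDoubles P + 6 * maxDeg k + 2 * maxDeg k ^ 2 < degSum k) :
    0 < fLoop P := by
  classical
  obtain ⟨x, hx⟩ : (loopPoints P).Nonempty := by
    rw [← Finset.card_pos, card_loopPoints]; omega
  rw [mem_loopPoints] at hx
  obtain ⟨a, ha⟩ : (available P {x.1} x.1 x.1).Nonempty := by
    rw [← Finset.card_pos]
    have := degSum_le_card_available P {x.1} x.1 x.1
    rw [Finset.card_singleton] at this
    omega
  have hS : ({x.1, a.1, (P.1 a).1} : Finset (Fin n)).card * maxDeg k ≤ 3 * maxDeg k :=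
    Nat.mul_le_mul_right _ Finset.card_le_three
  obtain ⟨c, hc⟩ : (available P {x.1, a.1, (P.1 a).1} a.1 x.1).Nonempty := by
    rw [← Finset.card_pos]
    have := degSum_le_card_available P {x.1, a.1, (P.1 a).1} a.1 x.1
    rw [mul_assoc] at this
    omega
  rw [mem_available] at ha hc
  obtain ⟨a1, a2, a3, a4, a5, a6⟩ := ha
  obtain ⟨c1, c2, c3, c4, c5, c6⟩ := hc
  simp only [Finset.mem_singleton, Finset.mem_insert, not_or] at a3 a4 c3 c4
  obtain ⟨Q, hQ⟩ := exists_loopSwitching_from hP (s := ![a, P.1 a, x, P.1 x, c, P.1 c]) rfl rfl rfl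
    hx (by
      simp only [Matrix.cons_val, List.nodup_cons, List.mem_cons, List.not_mem_nil, or_false,
        not_or, not_false_eq_true, List.nodup_nil, and_true]
      exact ⟨⟨a1, a3, Ne.symm c3.2.1, Ne.symm c4.2.1⟩, ⟨a4, Ne.symm c3.2.2, Ne.symm c4.2.2⟩,
        ⟨Ne.symm c3.1, Ne.symm c4.1⟩, c1⟩)
    (mult_eq_one_of_notMem a1 a2) (mult_eq_one_of_notMem c1 c2) c5
    (by rw [mult_comm]; exact a6) (by
      change mult P (P.1 x).1 (P.1 c).1 = 0
      rw [← hx]; exact c6)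
  exact Finset.card_pos.2 ⟨(_, Q), by simpa [loopSwitchings] using hQ⟩

/-- Greedy choice as for loops. The choice of `d` must avoid four cells, which accounts for 8 k_max
in `hM`. -/
theorem fDouble_pos {P : Configuration k} (hP : IsGood P) (hd : 0 < numDoubles P)
    (hM : 2 * numLoops P + 4 * numDoubles P + 8 * maxDeg k + 2 * maxDeg k ^ 2 < degSum k) :
    0 < fDouble P := by
  classical
  obtain ⟨u, v, huv, hm⟩ : ∃ u v, u ≠ v ∧ 1 < mult P u v := by
    by_contra! hcon
    refine hd.ne' (Finset.sum_eq_zero fun u _ => Finset.sum_eq_zero fun v hv => ?_)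
    exact Nat.choose_eq_zero_of_lt
      (lt_of_le_of_lt (hcon u v (Finset.mem_filter.1 hv).2.ne) one_lt_two)
  obtain ⟨b, hb, c, hc, hbc⟩ := Finset.one_lt_card.1 hm
  simp only [Finset.mem_filter, Finset.mem_univ, true_and] at hb hc
  obtain ⟨rfl, rfl⟩ := hb
  have hS : ({b.1, (P.1 b).1} : Finset (Fin n)).card * maxDeg k ≤ 2 * maxDeg k :=
    Nat.mul_le_mul_right _ Finset.card_le_two
  obtain ⟨a, ha⟩ : (available P {b.1, (P.1 b).1} b.1 (P.1 b).1).Nonempty := by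
    rw [← Finset.card_pos]
    have := degSum_le_card_available P {b.1, (P.1 b).1} b.1 (P.1 b).1
    rw [mul_assoc] at this
    omega
  have hS : ({b.1, (P.1 b).1, a.1, (P.1 a).1} : Finset (Fin n)).card * maxDeg k ≤ 4 * maxDeg k :=
    Nat.mul_le_mul_right _ Finset.card_le_four
  obtain ⟨d, hd⟩ : (available P {b.1, (P.1 b).1, a.1, (P.1 a).1} b.1 (P.1 b).1).Nonempty := by
    rw [← Finset.card_pos]
    have := degSum_le_card_available P {b.1, (P.1 b).1, a.1, (P.1 a).1} b.1 (P.1 b).1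
    rw [mul_assoc] at this
    omega
  rw [mem_available] at ha hd
  obtain ⟨a1, a2, a3, a4, a5, a6⟩ := ha
  obtain ⟨d1, d2, d3, d4, d5, d6⟩ := hd
  simp only [Finset.mem_singleton, Finset.mem_insert, not_or] at a3 a4 d3 d4
  obtain ⟨Q, hQ⟩ := exists_doubleSwitching_from hP
    (s := ![a, b, c, d, P.1 a, P.1 b, P.1 c, P.1 d]) rfl rfl rfl rfl hbc hc.1.symm hc.2.symm
    (by
      simp only [Matrix.cons_val, List.nodup_cons, List.mem_cons, List.not_mem_nil, or_false,
        not_or, not_false_eq_true, List.nodup_nil, and_true]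
      exact ⟨⟨a3.1, Ne.symm d3.2.2.1, a1, a3.2, Ne.symm d4.2.2.1⟩,
        ⟨Ne.symm d3.1, Ne.symm a4.1, huv, Ne.symm d4.1⟩, ⟨d3.2.2.2, d3.2.1, d1⟩,
        ⟨a4.2, Ne.symm d4.2.2.2⟩, Ne.symm d4.2.1⟩)
    (mult_eq_one_of_notMem a1 a2) (mult_eq_one_of_notMem d1 d2)
    (by rw [mult_comm]; exact a5)
    (by change mult P c.1 d.1 = 0; rw [hc.1]; exact d5)
    (by rw [mult_comm]; exact a6)
    (by change mult P (P.1 c).1 (P.1 d).1 = 0; rw [hc.2]; exact d6)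
  exact Finset.card_pos.2 ⟨(_, Q), by simpa [doubleSwitchings] using hQ⟩

/-! ### Lower bounds for the numbers of ways to produce a configuration -/

/-- To undo a loop-switching, take two points `x`, `y` of a loop-free cell, neither in a double
pair, and then an available point `a`; partners in `Q` supply the rest. The first choice excludes at
most ℓ k_max² + 8 d k_max of the M₂ ordered pairs, the second at most β of the M points. -/
theorem explicitLoop_le_bLoop {Q : Configuration k} (hQ : IsGood Q)
    (hl : (numLoops Q : ℝ) + 1 ≤ loopCap k) :
    explicitLoop k (numLoops Q) (numDoubles Q) ≤ bLoop Q := by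
  set S := (cellPairs k).filter fun x => mult Q x.1.1 x.1.1 = 0 ∧ x.1 ∉ doublePoints Q ∧
    x.2 ∉ doublePoints Q with hSdef
  have hS : degSumTwo k ≤ S.card +
      (numLoops Q * maxDeg k ^ 2 + 8 * numDoubles Q * maxDeg k) := by
    rw [← card_cellPairs]
    have h0 := card_le_filter_add (S := cellPairs k)
      (q := fun x => mult Q x.1.1 x.1.1 = 0 ∧ x.1 ∉ doublePoints Q ∧ x.2 ∉ doublePoints Q)
      (r := fun x => mult Q x.1.1 x.1.1 ≠ 0 ∨ x.1 ∈ doublePoints Q ∨ x.2 ∈ doublePoints Q)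
      (fun x _ => by tauto)
    have h1 := card_filter_le_add (S := cellPairs k)
      (p := fun x => mult Q x.1.1 x.1.1 ≠ 0 ∨ x.1 ∈ doublePoints Q ∨ x.2 ∈ doublePoints Q)
      (fun x _ h => h)
    have h2 := card_filter_le_add (S := cellPairs k)
      (p := fun x => x.1 ∈ doublePoints Q ∨ x.2 ∈ doublePoints Q) (fun x _ h => h)
    have b1 := card_cellPairs_cell_mem_le (k := k) (Finset.univ.filter fun v => mult Q v v ≠ 0)
    simp only [Finset.mem_filter, Finset.mem_univ, true_and] at b1
    have b1' := b1.trans (Nat.mul_le_mul_right _ (card_loop_cells_le Q))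
    have b2 := (card_cellPairs_fst_mem_le (doublePoints Q)).trans
      (Nat.mul_le_mul_right _ (card_doublePoints_le Q))
    have b3 := (card_cellPairs_snd_mem_le (doublePoints Q)).trans
      (Nat.mul_le_mul_right _ (card_doublePoints_le Q))
    have e : 8 * numDoubles Q * maxDeg k =
      4 * numDoubles Q * maxDeg k + 4 * numDoubles Q * maxDeg k := by ring
    rw [← hSdef] at h0
    omega
  -- The exclusions in `degSum_le_card_available` for a set `S` of at most three cells.
  set β := 2 * numLoops Q + 4 * numDoubles Q + 6 * maxDeg k + 2 * maxDeg k ^ 2 with hβ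
  have hc : degSum k ≤ (degSum k - β) + β := by omega
  have hN : S.card * (degSum k - β) ≤ bLoop Q := by
    refine mul_le_card S
      (fun x => available Q {x.1.1, (Q.1 x.1).1, (Q.1 x.2).1} (Q.1 x.1).1 (Q.1 x.2).1) _
      (fun z => (z.1 2, z.1 3)) (fun z => z.1 0) _ ?_ ?_
    · intro x _
      have h1 := degSum_le_card_available Q {x.1.1, (Q.1 x.1).1, (Q.1 x.2).1}
        (Q.1 x.1).1 (Q.1 x.2).1
      have h2 : ({x.1.1, (Q.1 x.1).1, (Q.1 x.2).1} : Finset (Fin n)).card * maxDeg k ≤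
        3 * maxDeg k := Nat.mul_le_mul_right _ Finset.card_le_three
      rw [mul_assoc] at h1
      omega
    · rintro ⟨x, y⟩ hxy a ha
      rw [hSdef, Finset.mem_filter, mem_cellPairs] at hxy
      rw [mem_available] at ha
      obtain ⟨⟨h1, h2⟩, h3, h4, h5⟩ := hxy
      obtain ⟨a1, a2, a3, a4, a5, a6⟩ := ha
      simp only [Finset.mem_singleton, Finset.mem_insert, not_or] at a3 a4 h1 h2 h3 h4 h5 a5 a6
      have hx : x.1 ≠ (Q.1 x).1 := fun h => by
        have := mult_pos Q x
        rw [← h] at this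
        omega
      have hy : y.1 ≠ (Q.1 y).1 := fun h => by
        have := mult_pos Q y
        rw [← h, ← h1] at this
        omega
      have mx := mult_eq_one_of_notMem hx h4
      have my := mult_eq_one_of_notMem hy h5
      have hxy := partner_cell_ne h2 h1 mx
      obtain ⟨P, hP⟩ := exists_loopSwitching_to hQ hl (s := ![a, Q.1 x, x, y, Q.1 a, Q.1 y])
        rfl (Q.2.1 x) rfl h2 h1
        (by
          simp only [Matrix.cons_val, List.nodup_cons, List.mem_cons, List.not_mem_nil, or_false,
            not_or, not_false_eq_true, List.nodup_nil, and_true]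
          exact ⟨⟨a3.2.1, a3.1, a1, a3.2.2⟩, ⟨hx.symm, Ne.symm a4.2.1, hxy⟩,
            ⟨Ne.symm a4.1, h1 ▸ hy⟩, a4.2.2⟩)
        h3 (mult_eq_one_of_notMem a1 a2) (by rw [mult_comm]; exact mx) my
        (by rw [mult_comm]; exact a5) (by rw [mult_comm]; exact a6)
      exact ⟨(_, P), by simpa using hP, rfl, rfl⟩
  have := product_lower_bound hS hc hN
  refine le_trans (le_of_eq ?_) this
  rw [explicitLoop, hβ]
  push_cast
  ring

/-- To undo a double-switching, take the pairs of points `(b, c)` and `(f, g)`, each within one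
cell; their partners in `Q` are the other four points. Each pair loses 8 d k_max choices to double
pairs. The second must also keep three cells off the three in use (3·3 k_max²) and avoid three
adjacencies (3 k_max³). -/
theorem explicitDouble_le_bDouble {Q : Configuration k} (hQ : IsGood Q) (hl : numLoops Q = 0)
    (hd : (numDoubles Q : ℝ) + 1 ≤ doubleCap k) :
    explicitDouble k (numDoubles Q) ≤ bDouble Q := by
  have no_loop : ∀ p : Point k, p.1 ≠ (Q.1 p).1 := by
    intro p hp
    have h := card_loopPoints Q
    rw [hl, mul_zero, Finset.card_eq_zero] at h
    exact absurd (mem_loopPoints.2 hp) (by simp [h])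
  have b2 := (card_cellPairs_fst_mem_le (doublePoints Q)).trans
    (Nat.mul_le_mul_right _ (card_doublePoints_le Q))
  have b3 := (card_cellPairs_snd_mem_le (doublePoints Q)).trans
    (Nat.mul_le_mul_right _ (card_doublePoints_le Q))
  have e8 : 8 * numDoubles Q * maxDeg k =
    4 * numDoubles Q * maxDeg k + 4 * numDoubles Q * maxDeg k := by ring
  set S := (cellPairs k).filter fun x => x.1 ∉ doublePoints Q ∧ x.2 ∉ doublePoints Q with hSdef
  have hS : degSumTwo k ≤ S.card + 8 * numDoubles Q * maxDeg k := by
    rw [← card_cellPairs]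
    have h0 := card_le_filter_add (S := cellPairs k)
      (q := fun x => x.1 ∉ doublePoints Q ∧ x.2 ∉ doublePoints Q)
      (r := fun x => x.1 ∈ doublePoints Q ∨ x.2 ∈ doublePoints Q)
      (fun x _ => by tauto)
    have h2 := card_filter_le_add (S := cellPairs k)
      (p := fun x => x.1 ∈ doublePoints Q ∨ x.2 ∈ doublePoints Q) (fun x _ h => h)
    rw [← hSdef] at h0
    omega
  set A : Point k × Point k → Finset (Point k × Point k) := fun x => S.filter fun y =>
    y.1.1 ∉ ({x.1.1, (Q.1 x.1).1, (Q.1 x.2).1} : Finset (Fin n)) ∧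
    (Q.1 y.1).1 ∉ ({x.1.1, (Q.1 x.1).1, (Q.1 x.2).1} : Finset (Fin n)) ∧
    (Q.1 y.2).1 ∉ ({x.1.1, (Q.1 x.1).1, (Q.1 x.2).1} : Finset (Fin n)) ∧
    mult Q x.1.1 y.1.1 = 0 ∧ mult Q (Q.1 x.1).1 (Q.1 y.1).1 = 0 ∧
    mult Q (Q.1 x.2).1 (Q.1 y.2).1 = 0 with hA
  set β := 8 * numDoubles Q * maxDeg k + 9 * maxDeg k ^ 2 + 3 * maxDeg k ^ 3 with hβ
  have hAc : ∀ x, degSumTwo k ≤ (A x).card + β := by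
    intro x
    set T : Finset (Fin n) := {x.1.1, (Q.1 x.1).1, (Q.1 x.2).1} with hT
    have hTc : T.card ≤ 3 := Finset.card_le_three
    have h0 := card_le_filter_add (S := S)
      (q := fun y => y.1.1 ∉ T ∧ (Q.1 y.1).1 ∉ T ∧ (Q.1 y.2).1 ∉ T ∧
        mult Q x.1.1 y.1.1 = 0 ∧ mult Q (Q.1 x.1).1 (Q.1 y.1).1 = 0 ∧
        mult Q (Q.1 x.2).1 (Q.1 y.2).1 = 0)
      (r := fun y => y.1.1 ∈ T ∨ (Q.1 y.1).1 ∈ T ∨ (Q.1 y.2).1 ∈ T ∨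
        mult Q x.1.1 y.1.1 ≠ 0 ∨ mult Q (Q.1 x.1).1 (Q.1 y.1).1 ≠ 0 ∨
        mult Q (Q.1 x.2).1 (Q.1 y.2).1 ≠ 0)
      (fun y _ => by tauto)
    -- Exclusions beyond those already made in `S` may be counted among all of `cellPairs`.
    have hsub : ∀ (p : Point k × Point k → Prop) [DecidablePred p],
        (S.filter p).card ≤ ((cellPairs k).filter p).card := fun p _ =>
      Finset.card_le_card (Finset.filter_subset_filter _ (Finset.filter_subset _ _))
    have h1 := hsub (fun y => y.1.1 ∈ T ∨ (Q.1 y.1).1 ∈ T ∨ (Q.1 y.2).1 ∈ T ∨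
        mult Q x.1.1 y.1.1 ≠ 0 ∨ mult Q (Q.1 x.1).1 (Q.1 y.1).1 ≠ 0 ∨
        mult Q (Q.1 x.2).1 (Q.1 y.2).1 ≠ 0)
    have h2 := card_filter_le_add (S := cellPairs k)
      (p := fun y => y.1.1 ∈ T ∨ (Q.1 y.1).1 ∈ T ∨ (Q.1 y.2).1 ∈ T ∨
        mult Q x.1.1 y.1.1 ≠ 0 ∨ mult Q (Q.1 x.1).1 (Q.1 y.1).1 ≠ 0 ∨
        mult Q (Q.1 x.2).1 (Q.1 y.2).1 ≠ 0) (fun _ _ h => h)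
    have h3 := card_filter_le_add (S := cellPairs k)
      (p := fun y => (Q.1 y.1).1 ∈ T ∨ (Q.1 y.2).1 ∈ T ∨
        mult Q x.1.1 y.1.1 ≠ 0 ∨ mult Q (Q.1 x.1).1 (Q.1 y.1).1 ≠ 0 ∨
        mult Q (Q.1 x.2).1 (Q.1 y.2).1 ≠ 0) (fun _ _ h => h)
    have h4 := card_filter_le_add (S := cellPairs k)
      (p := fun y => (Q.1 y.2).1 ∈ T ∨
        mult Q x.1.1 y.1.1 ≠ 0 ∨ mult Q (Q.1 x.1).1 (Q.1 y.1).1 ≠ 0 ∨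
        mult Q (Q.1 x.2).1 (Q.1 y.2).1 ≠ 0) (fun _ _ h => h)
    have h5 := card_filter_le_add (S := cellPairs k)
      (p := fun y => mult Q x.1.1 y.1.1 ≠ 0 ∨ mult Q (Q.1 x.1).1 (Q.1 y.1).1 ≠ 0 ∨
        mult Q (Q.1 x.2).1 (Q.1 y.2).1 ≠ 0) (fun _ _ h => h)
    have h6 := card_filter_le_add (S := cellPairs k)
      (p := fun y => mult Q (Q.1 x.1).1 (Q.1 y.1).1 ≠ 0 ∨
        mult Q (Q.1 x.2).1 (Q.1 y.2).1 ≠ 0) (fun _ _ h => h)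
    have fstB : ∀ (p : Point k → Prop) [DecidablePred p] (c : ℕ),
        (Finset.univ.filter p).card ≤ c →
        ((cellPairs k).filter fun y => p y.1).card ≤ c * maxDeg k := by
      intro p _ c hc
      have := card_cellPairs_fst_mem_le (Finset.univ.filter p)
      simp only [Finset.mem_filter, Finset.mem_univ, true_and] at this
      exact this.trans (Nat.mul_le_mul_right _ hc)
    have sndB : ∀ (p : Point k → Prop) [DecidablePred p] (c : ℕ),
        (Finset.univ.filter p).card ≤ c →
        ((cellPairs k).filter fun y => p y.2).card ≤ c * maxDeg k := by
      intro p _ c hc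
      have := card_cellPairs_snd_mem_le (Finset.univ.filter p)
      simp only [Finset.mem_filter, Finset.mem_univ, true_and] at this
      exact this.trans (Nat.mul_le_mul_right _ hc)
    have hT3 := (card_mem_cells_le (k := k) T).trans (Nat.mul_le_mul_right _ hTc)
    have c1 := fstB (fun p => p.1 ∈ T) _ hT3
    have c2 := fstB (fun p => (Q.1 p).1 ∈ T) _
      ((card_filter_partner Q fun p => p.1 ∈ T).trans_le hT3)
    have c3 := sndB (fun p => (Q.1 p).1 ∈ T) _
      ((card_filter_partner Q fun p => p.1 ∈ T).trans_le hT3)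
    have c4 := fstB (fun p => mult Q x.1.1 p.1 ≠ 0) _ (card_linked_le Q _)
    have c5 := fstB (fun p => mult Q (Q.1 x.1).1 (Q.1 p).1 ≠ 0) _
      ((card_filter_partner Q fun p => mult Q (Q.1 x.1).1 p.1 ≠ 0).trans_le (card_linked_le Q _))
    have c6 := sndB (fun p => mult Q (Q.1 x.2).1 (Q.1 p).1 ≠ 0) _
      ((card_filter_partner Q fun p => mult Q (Q.1 x.2).1 p.1 ≠ 0).trans_le (card_linked_le Q _))
    have e1 : 3 * maxDeg k * maxDeg k = 3 * maxDeg k ^ 2 := by ring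
    have e2 : maxDeg k ^ 2 * maxDeg k = maxDeg k ^ 3 := by ring
    rw [e1] at c1 c2 c3
    rw [e2] at c4 c5 c6
    change degSumTwo k ≤ (S.filter fun y => y.1.1 ∉ T ∧ (Q.1 y.1).1 ∉ T ∧ (Q.1 y.2).1 ∉ T ∧
        mult Q x.1.1 y.1.1 = 0 ∧ mult Q (Q.1 x.1).1 (Q.1 y.1).1 = 0 ∧
        mult Q (Q.1 x.2).1 (Q.1 y.2).1 = 0).card + β
    omega
  have hN : S.card * (degSumTwo k - β) ≤ bDouble Q := by
    refine mul_le_card S A _ (fun z => (z.1 1, z.1 2)) (fun z => (z.1 5, z.1 6)) _ ?_ ?_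
    · intro x _
      have := hAc x
      omega
    · rintro ⟨b, c⟩ hbc ⟨f, g⟩ hfg
      rw [hA, Finset.mem_filter] at hfg
      obtain ⟨hfg, h⟩ := hfg
      rw [hSdef, Finset.mem_filter, mem_cellPairs] at hbc hfg
      obtain ⟨⟨h1, h2⟩, h3, h4⟩ := hbc
      obtain ⟨⟨i1, i2⟩, i3, i4⟩ := hfg
      obtain ⟨j1, j2, j3, j4, j5, j6⟩ := h
      simp only [Finset.mem_singleton, Finset.mem_insert, not_or] at *
      have mb := mult_eq_one_of_notMem (no_loop b) h3
      have mc := mult_eq_one_of_notMem (no_loop c) h4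
      have mf := mult_eq_one_of_notMem (no_loop f) i3
      have mg := mult_eq_one_of_notMem (no_loop g) i4
      have hbc := partner_cell_ne h2 h1 mb
      have hfg := partner_cell_ne i2 i1 mf
      obtain ⟨P, hP⟩ := exists_doubleSwitching_to hQ hd
        (s := ![Q.1 b, b, c, Q.1 c, Q.1 f, f, g, Q.1 g])
        (Q.2.1 b) rfl (Q.2.1 f) rfl h2 i2 h1 i1
        (by
          simp only [Matrix.cons_val, List.nodup_cons, List.mem_cons, List.not_mem_nil, or_false,
            not_or, not_false_eq_true, List.nodup_nil, and_true]
          exact ⟨⟨(no_loop b).symm, hbc, Ne.symm j2.2.1, Ne.symm j1.2.1, Ne.symm j3.2.1⟩,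
            ⟨h1 ▸ no_loop c, Ne.symm j2.1, Ne.symm j1.1, Ne.symm j3.1⟩,
            ⟨Ne.symm j2.2.2, Ne.symm j1.2.2, Ne.symm j3.2.2⟩,
            ⟨(no_loop f).symm, hfg⟩, i1 ▸ no_loop g⟩)
        (by rw [mult_comm]; exact mb) mc (by rw [mult_comm]; exact mf) mg j5 j6 j4
      exact ⟨(_, P), by simpa using hP, rfl, rfl⟩
  have hc : degSumTwo k ≤ (degSumTwo k - β) + β := by omega
  have := product_lower_bound hS hc hN
  refine le_trans (le_of_eq ?_) this
  rw [explicitDouble, hβ]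
  push_cast
  ring

end Counting

/-! ### The range of large M: positivity of the bounds and the rejection probabilities. -/

section Regime

variable {n : ℕ} {k : Fin n → ℕ}

/-- If M ≤ 100 k_max³, then k_max⁴ ≤ 100 |C| k_max³, so k_max ≤ 100 |C| and M is bounded. The added
1 makes the contradiction strict and also rules out k_max = 0. -/
theorem exists_threshold (C : ℝ) : ∃ M₀ : ℕ, ∀ (n : ℕ) (k : Fin n → ℕ),
    (maxDeg k : ℝ) ^ 4 ≤ C * degSum k → M₀ ≤ degSum k → 100 * maxDeg k ^ 3 < degSum k := by
  refine ⟨⌈100 * (100 * |C|) ^ 3⌉₊ + 1, fun n k h hM => ?_⟩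
  by_contra hcon
  have hcon' : (degSum k : ℝ) ≤ 100 * (maxDeg k : ℝ) ^ 3 := by exact_mod_cast not_lt.1 hcon
  have hK0 : (0 : ℝ) ≤ maxDeg k := Nat.cast_nonneg _
  have hK : 0 < (maxDeg k : ℝ) := by
    rcases hK0.eq_or_lt with h0 | h0
    · rw [← h0] at hcon'
      have : (1 : ℝ) ≤ degSum k := by exact_mod_cast (le_trans (Nat.le_add_left _ _) hM)
      norm_num at hcon'
      linarith
    · exact h0
  have h1 : (maxDeg k : ℝ) ^ 4 ≤ |C| * (100 * (maxDeg k : ℝ) ^ 3) :=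
    h.trans ((mul_le_mul_of_nonneg_right (le_abs_self C) (Nat.cast_nonneg _)).trans
      (mul_le_mul_of_nonneg_left hcon' (abs_nonneg C)))
  have h2 : (maxDeg k : ℝ) ≤ 100 * |C| := by
    have h3 : 0 < (maxDeg k : ℝ) ^ 3 := by positivity
    refine le_of_mul_le_mul_right ?_ h3
    linarith [pow_succ' (maxDeg k : ℝ) 3]
  have h4 : (maxDeg k : ℝ) ^ 3 ≤ (100 * |C|) ^ 3 := pow_le_pow_left₀ hK0 h2 3
  have h5 : (⌈100 * (100 * |C|) ^ 3⌉₊ : ℝ) + 1 ≤ degSum k := by exact_mod_cast hM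
  have h6 := Nat.le_ceil (100 * (100 * |C|) ^ 3)
  linarith

theorem one_le_maxDeg (hM : 100 * maxDeg k ^ 3 < degSum k) : 1 ≤ maxDeg k := by
  by_contra h
  have h0 : maxDeg k = 0 := by omega
  have : degSum k = 0 := Finset.sum_eq_zero fun v _ => by
    have := le_maxDeg k v
    omega
  omega

theorem loopCap_nonneg (k : Fin n → ℕ) : 0 ≤ loopCap k := by unfold loopCap; positivity

theorem doubleCap_eq (k : Fin n → ℕ) : doubleCap k = loopCap k ^ 2 := rfl

theorem loopCap_le (k : Fin n → ℕ) : loopCap k ≤ maxDeg k := by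
  refine div_le_of_le_mul₀ (Nat.cast_nonneg _) (Nat.cast_nonneg _) ?_
  exact_mod_cast degSumTwo_le k

theorem doubleCap_le (k : Fin n → ℕ) : doubleCap k ≤ (maxDeg k : ℝ) ^ 2 :=
  pow_le_pow_left₀ (loopCap_nonneg k) (loopCap_le k) 2

theorem IsGood.numLoops_le_maxDeg {P : Configuration k} (h : IsGood P) :
    numLoops P ≤ maxDeg k := by
  exact_mod_cast h.numLoops_le.trans (loopCap_le k)

theorem IsGood.numDoubles_le_maxDeg {P : Configuration k} (h : IsGood P) :
    numDoubles P ≤ maxDeg k ^ 2 := by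
  exact_mod_cast h.numDoubles_le.trans (doubleCap_le k)

theorem fLoop_pos_of_large (hM : 100 * maxDeg k ^ 3 < degSum k) {P : Configuration k}
    (hP : IsGood P) (hl : 0 < numLoops P) : 0 < fLoop P := by
  have hK := one_le_maxDeg hM
  have h1 := hP.numLoops_le_maxDeg
  have h2 := hP.numDoubles_le_maxDeg
  have h3 : maxDeg k ^ 1 ≤ maxDeg k ^ 3 := Nat.pow_le_pow_right hK (by norm_num)
  have h4 : maxDeg k ^ 2 ≤ maxDeg k ^ 3 := Nat.pow_le_pow_right hK (by norm_num)
  rw [pow_one] at h3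
  exact fLoop_pos hP hl (by omega)

theorem fDouble_pos_of_large (hM : 100 * maxDeg k ^ 3 < degSum k) {P : Configuration k}
    (hP : IsGood P) (hd : 0 < numDoubles P) : 0 < fDouble P := by
  have hK := one_le_maxDeg hM
  have h1 := hP.numLoops_le_maxDeg
  have h2 := hP.numDoubles_le_maxDeg
  have h3 : maxDeg k ^ 1 ≤ maxDeg k ^ 3 := Nat.pow_le_pow_right hK (by norm_num)
  have h4 : maxDeg k ^ 2 ≤ maxDeg k ^ 3 := Nat.pow_le_pow_right hK (by norm_num)
  rw [pow_one] at h3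
  exact fDouble_pos hP hd (by omega)

theorem explicitLoop_pos (hM : 100 * maxDeg k ^ 3 < degSum k) {l d : ℕ}
    (hl : (l : ℝ) + 1 ≤ loopCap k) (hd : (d : ℝ) ≤ doubleCap k) : 0 < explicitLoop k l d := by
  have hK : (1 : ℝ) ≤ maxDeg k := by exact_mod_cast one_le_maxDeg hM
  have hM' : 100 * (maxDeg k : ℝ) ^ 3 < degSum k := by exact_mod_cast hM
  have hB := loopCap_le k
  have hB0 := loopCap_nonneg k
  have hMpos : 0 < (degSum k : ℝ) := lt_of_le_of_lt (by positivity) hM'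
  have hM2 : (degSumTwo k : ℝ) = loopCap k * degSum k := by
    rw [loopCap, div_mul_cancel₀ _ hMpos.ne']
  have hl0 : (0 : ℝ) ≤ l := Nat.cast_nonneg l
  rw [doubleCap_eq] at hd
  rw [explicitLoop, hM2]
  set K := (maxDeg k : ℝ)
  set M := (degSum k : ℝ)
  set B := loopCap k
  have hBpos : 0 < B := by linarith
  -- Two bounds for d ≤ B²: K·B keeps the factor B needed against M·M₂ = B·M², while K² serves where
  -- M₂ = B·M already supplies B. All subtracted terms together are at most (15K² + 8K)·B·M ≤
  -- 23K³·B·M.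
  have hd1 : (d : ℝ) ≤ K * B := hd.trans (by rw [sq]; exact mul_le_mul_of_nonneg_right hB hB0)
  have hd2 : (d : ℝ) ≤ K ^ 2 := hd.trans (pow_le_pow_left₀ hB0 hB 2)
  have h1 : (l : ℝ) * K ^ 2 * M ≤ B * K ^ 2 * M := by gcongr; linarith
  have h2 : 8 * (d : ℝ) * K * M ≤ 8 * (K * B) * K * M := by gcongr
  have h3 : (2 * (l : ℝ) + 4 * d + 6 * K + 2 * K ^ 2) * (B * M) ≤
      (2 * K + 4 * K ^ 2 + 6 * K + 2 * K ^ 2) * (B * M) := by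
    gcongr
    linarith
  have h4 : 0 < M - (23 * K ^ 3) := by
    have : 0 < K ^ 3 := by positivity
    linarith
  have h5 : 0 ≤ 23 * K ^ 3 - (15 * K ^ 2 + 8 * K) := by
    nlinarith [mul_nonneg (sub_nonneg.2 hK) (sub_nonneg.2 hK), sq_nonneg K]
  nlinarith [mul_pos (mul_pos hBpos hMpos) h4, mul_nonneg (mul_pos hBpos hMpos).le h5]

theorem explicitDouble_pos (hM : 100 * maxDeg k ^ 3 < degSum k) {d : ℕ}
    (hd : (d : ℝ) + 1 ≤ doubleCap k) : 0 < explicitDouble k d := by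
  have hK : (1 : ℝ) ≤ maxDeg k := by exact_mod_cast one_le_maxDeg hM
  have hM' : 100 * (maxDeg k : ℝ) ^ 3 < degSum k := by exact_mod_cast hM
  have hB := loopCap_le k
  have hB0 := loopCap_nonneg k
  have hMpos : 0 < (degSum k : ℝ) := lt_of_le_of_lt (by positivity) hM'
  have hM2 : (degSumTwo k : ℝ) = loopCap k * degSum k := by
    rw [loopCap, div_mul_cancel₀ _ hMpos.ne']
  have hd2 : (d : ℝ) ≤ (maxDeg k : ℝ) ^ 2 := by linarith [doubleCap_le k]
  have hd0 : (0 : ℝ) ≤ d := Nat.cast_nonneg d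
  rw [doubleCap_eq] at hd
  -- The range of `d` forces B₂ ≥ 1. Hence M₂ ≥ M > 100K³, which beats 16K³ + 9K² + 3K³ ≤ 28K³.
  have hB1 : 1 ≤ loopCap k := by
    by_contra h
    nlinarith
  have hle : (degSum k : ℝ) ≤ degSumTwo k := by rw [hM2]; nlinarith
  rw [explicitDouble]
  set K := (maxDeg k : ℝ)
  have h1 : 16 * (d : ℝ) * K ≤ 16 * K ^ 2 * K := by gcongr
  have h2 : 0 ≤ K ^ 2 * (K - 1) := mul_nonneg (by positivity) (by linarith)
  have h3 : 0 < (degSumTwo k : ℝ) - (16 * d * K + 9 * K ^ 2 + 3 * K ^ 3) := by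
    have : 0 < K ^ 3 := by positivity
    nlinarith
  nlinarith [mul_pos (hMpos.trans_le hle) h3]

theorem areLowerBounds_explicit (hM : 100 * maxDeg k ^ 3 < degSum k) :
    AreLowerBounds k (explicitLoop k) (explicitDouble k) where
  loop_pos l d hl hd := explicitLoop_pos hM hl hd
  loop_le l d hl _ Q hQ := by
    obtain ⟨h, rfl, rfl⟩ := hQ
    exact explicitLoop_le_bLoop h hl
  double_pos d hd := explicitDouble_pos hM hd
  double_le d hd Q hQ := by
    obtain ⟨h, hl, rfl⟩ := hQ
    exact explicitDouble_le_bDouble h hl hd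

theorem one_sub_mem_Ico {f U b m : ℝ} (hf : 0 < f) (hfU : f ≤ U) (hm : 0 < m) (hmb : m ≤ b) :
    1 - f * m / (U * b) ∈ Set.Ico (0 : ℝ) 1 := by
  have hU : 0 < U := hf.trans_le hfU
  have hb : 0 < b := hm.trans_le hmb
  have h1 : 0 < f * m / (U * b) := by positivity
  have h2 : f * m / (U * b) ≤ 1 :=
    (div_le_one (by positivity)).2 (mul_le_mul hfU hmb hm.le hU.le)
  constructor <;> linarith

theorem bLoop_pos {P Q : Configuration k} {s : Fin 6 → Point k} (h : IsLoopSwitching P Q s) :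
    0 < bLoop Q := Finset.card_pos.2 ⟨(s, P), by simpa using h⟩

theorem bDouble_pos {P Q : Configuration k} {s : Fin 8 → Point k} (h : IsDoubleSwitching P Q s) :
    0 < bDouble Q := Finset.card_pos.2 ⟨(s, P), by simpa using h⟩

/-- The converse direction is what places every predecessor of `Q` in a single class. -/
theorem IsLoopSwitching.mem_goodWith_iff {P Q : Configuration k} {s : Fin 6 → Point k}
    (h : IsLoopSwitching P Q s) (l d : ℕ) : P ∈ goodWith k (l + 1) d ↔ Q ∈ goodWith k l d := by
  obtain ⟨h1, h2, h3⟩ := h.effect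
  have := h.good
  simp only [goodWith, Set.mem_ofPred_eq, this, h3, true_and]
  omega

theorem IsDoubleSwitching.mem_goodWith_iff {P Q : Configuration k} {s : Fin 8 → Point k}
    (h : IsDoubleSwitching P Q s) (d : ℕ) : P ∈ goodWith k 0 (d + 1) ↔ Q ∈ goodWith k 0 d := by
  obtain ⟨h1, h2, h3⟩ := h.effect
  have := h.good
  simp only [goodWith, Set.mem_ofPred_eq, this, h3, true_and]
  omega

/-- A good configuration with `l + 1` loops itself certifies that the indices lie in the range where
the bounds are assumed. -/
theorem AreLowerBounds.loop_of_mem {mL : ℕ → ℕ → ℝ} {mD : ℕ → ℝ} (h : AreLowerBounds k mL mD)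
    {l d : ℕ} {P : Configuration k} (hP : P ∈ goodWith k (l + 1) d) :
    0 < mL l d ∧ ∀ Q ∈ goodWith k l d, mL l d ≤ bLoop Q := by
  obtain ⟨hg, h1, rfl⟩ := hP
  have h2 := hg.numLoops_le
  rw [h1] at h2
  push_cast at h2
  exact ⟨h.loop_pos l _ h2 hg.numDoubles_le, h.loop_le l _ h2 hg.numDoubles_le⟩

theorem AreLowerBounds.double_of_mem {mL : ℕ → ℕ → ℝ} {mD : ℕ → ℝ} (h : AreLowerBounds k mL mD)
    {d : ℕ} {P : Configuration k} (hP : P ∈ goodWith k 0 (d + 1)) :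
    0 < mD d ∧ ∀ Q ∈ goodWith k 0 d, mD d ≤ bDouble Q := by
  obtain ⟨hg, -, h1⟩ := hP
  have h2 := hg.numDoubles_le
  rw [h1] at h2
  push_cast at h2
  exact ⟨h.double_pos d h2, h.double_le d h2⟩

theorem qLoop_mem (hM : 100 * maxDeg k ^ 3 < degSum k) {mL : ℕ → ℕ → ℝ} {mD : ℕ → ℝ}
    (h : AreLowerBounds k mL mD) {l d : ℕ} {P Q : Configuration k}
    (hP : P ∈ goodWith k (l + 1) d) (hQ : Q ∈ goodWith k l d) :
    qLoop mL P Q ∈ Set.Ico (0 : ℝ) 1 := by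
  obtain ⟨h1, h2⟩ := h.loop_of_mem hP
  obtain ⟨hg, h3, h4⟩ := hP
  rw [qLoop]
  refine one_sub_mem_Ico ?_ ?_ ?_ ?_
  · exact_mod_cast fLoop_pos_of_large hM hg (by omega)
  · exact_mod_cast fLoop_le P
  · rwa [h3, h4]
  · rw [h3, h4]; exact h2 Q hQ

theorem qDouble_mem (hM : 100 * maxDeg k ^ 3 < degSum k) {mL : ℕ → ℕ → ℝ} {mD : ℕ → ℝ}
    (h : AreLowerBounds k mL mD) {d : ℕ} {P Q : Configuration k}
    (hP : P ∈ goodWith k 0 (d + 1)) (hQ : Q ∈ goodWith k 0 d) :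
    qDouble mD P Q ∈ Set.Ico (0 : ℝ) 1 := by
  obtain ⟨h1, h2⟩ := h.double_of_mem hP
  obtain ⟨hg, h3, h4⟩ := hP
  rw [qDouble]
  refine one_sub_mem_Ico ?_ ?_ ?_ ?_
  · exact_mod_cast fDouble_pos_of_large hM hg (by omega)
  · exact_mod_cast fDouble_le P
  · rwa [h4]
  · rw [h4]; exact h2 Q hQ

end Regime

/-! ### One accepted switching preserves uniformity. -/

section Uniformity

variable {n : ℕ} {k : Fin n → ℕ}

theorem coin_false {r : ℝ} (h0 : 0 ≤ r) (h1 : r ≤ 1) : coin (1 - r) false = ENNReal.ofReal r := by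
  have : min 1 (ENNReal.ofReal (1 - r)) = ENNReal.ofReal (1 - r) :=
    min_eq_right (by rw [← ENNReal.ofReal_one]; exact ENNReal.ofReal_le_ofReal (by linarith))
  rw [coin, PMF.ofFintype_apply]
  simp only [Bool.false_eq_true, if_false]
  rw [this, ← ENNReal.ofReal_one, ← ENNReal.ofReal_sub _ (by linarith), sub_sub_cancel]

/-- Choose a switching uniformly at random and reject it with probability `q`. -/
noncomputable def switchOrRestart {ι : Type*} (S : Finset (ι × Configuration k)) (h : S.Nonempty)
    (q : Configuration k → ℝ) : PMF (State k) :=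
  (PMF.uniformOfFinset S h).bind fun x =>
    (coin (q x.2)).map fun reject => if reject then .start else .run x.2

open Classical in
-- Rejection depends on a switching only through its result, so all switchings leading to `Q` carry
-- the same weight.
theorem switchOrRestart_run {ι : Type*} (S : Finset (ι × Configuration k)) (h : S.Nonempty)
    (q : Configuration k → ℝ) (Q : Configuration k) :
    switchOrRestart S h q (.run Q) =
      (S.filter fun x => x.2 = Q).card * ((S.card : ℝ≥0∞)⁻¹ * coin (q Q) false) := by
  rw [switchOrRestart, PMF.bind_apply, tsum_eq_sum (s := S)]
  · have : ∀ x ∈ S, (PMF.uniformOfFinset S h) x * ((coin (q x.2)).map fun reject =>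
        if reject then State.start else State.run x.2) (.run Q) =
        if x.2 = Q then (S.card : ℝ≥0∞)⁻¹ * coin (q Q) false else 0 := by
      intro x hx
      rw [PMF.uniformOfFinset_apply_of_mem h hx, PMF.map_apply, tsum_bool]
      by_cases hxQ : x.2 = Q
      · simp [hxQ]
      · simp [hxQ, Ne.symm hxQ]
    rw [Finset.sum_congr rfl this, ← Finset.sum_filter, Finset.sum_const, nsmul_eq_mul]
  · intro x hx
    rw [PMF.uniformOfFinset_apply_of_notMem h hx, zero_mul]

open Classical in
-- The cancellation common to both kinds of switching. The common mass of the elements of `C'` is m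
-- / (U |C|).
theorem stepMapsUniform_of_switching {ι : Type*} [Fintype ι] {mL : ℕ → ℕ → ℝ} {mD : ℕ → ℝ}
    (R : Configuration k → Configuration k → ι → Prop)
    (S : Configuration k → Finset (ι × Configuration k)) (hS : ∀ P x, x ∈ S P ↔ R P x.2 x.1)
    (b : Configuration k → ℕ)
    (hb : ∀ Q, b Q = (Finset.univ.filter fun x : ι × Configuration k => R x.2 Q x.1).card)
    (C C' : Set (Configuration k)) (hCC' : ∀ P Q s, R P Q s → (P ∈ C ↔ Q ∈ C'))
    (hC : C.Nonempty) (m U : ℝ) (hm : 0 < m) (hmb : ∀ Q ∈ C', m ≤ b Q)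
    (hU : ∀ P ∈ C, ((S P).card : ℝ) ≤ U)
    (hstep : ∀ P ∈ C, ∃ h : (S P).Nonempty, step mL mD (.run P) = switchOrRestart (S P) h
      fun Q => 1 - (S P).card * m / (U * b Q)) :
    StepMapsUniform mL mD C C' := by
  obtain ⟨P₀, hP₀⟩ := hC
  have hUpos : 0 < U := by
    obtain ⟨h, -⟩ := hstep P₀ hP₀
    exact lt_of_lt_of_le (by exact_mod_cast h.card_pos) (hU P₀ hP₀)
  have hC0 : (C.ncard : ℝ≥0∞)⁻¹ ≠ 0 := ENNReal.inv_ne_zero.2 (ENNReal.natCast_ne_top _)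
  refine ⟨?_, (C.ncard : ℝ≥0∞)⁻¹ * ENNReal.ofReal (m / U), ?_, fun Q => ⟨fun hQ => ?_, fun hQ => ?_⟩⟩
  · obtain ⟨⟨x, hx⟩, -⟩ := hstep P₀ hP₀
    exact ⟨x.2, (hCC' _ _ _ ((hS _ _).1 hx)).1 hP₀⟩
  · exact ENNReal.mul_pos hC0 (ENNReal.ofReal_pos.2 (by positivity)).ne'
  · congr 1
    have hbpos : (0 : ℝ) < b Q := hm.trans_le (hmb Q hQ)
    -- The number of switchings of `P` cancels between the uniform choice and the acceptance
    -- probability.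
    have h1 : ∀ P ∈ C.toFinite.toFinset, step mL mD (.run P) (.run Q) =
        ((S P).filter fun x => x.2 = Q).card * ENNReal.ofReal (m / (U * b Q)) := by
      intro P hP
      rw [Set.Finite.mem_toFinset] at hP
      obtain ⟨h, h2⟩ := hstep P hP
      have hc : (0 : ℝ) < (S P).card := by exact_mod_cast h.card_pos
      rw [h2, switchOrRestart_run, coin_false (by positivity)
        ((div_le_one (by positivity)).2 (mul_le_mul (hU P hP) (hmb Q hQ) hm.le hUpos.le))]
      congr 1
      rw [← ENNReal.ofReal_natCast, ← ENNReal.ofReal_inv_of_pos hc,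
        ← ENNReal.ofReal_mul (by positivity)]
      congr 1
      field_simp
    rw [Finset.sum_congr rfl h1, ← Finset.sum_mul]
    -- Summing over `P` in `C` counts every switching that produces `Q`, since by `hCC'` all of them
    -- start in `C`.
    have h2 : (∑ P ∈ C.toFinite.toFinset, (((S P).filter fun x => x.2 = Q).card : ℝ≥0∞)) = b Q := by
      rw [← Nat.cast_sum, hb Q]
      congr 1
      rw [Finset.card_eq_sum_card_fiberwise (f := fun x : ι × Configuration k => x.2)
        (t := C.toFinite.toFinset)]
      · refine Finset.sum_congr rfl fun P _ => ?_
        refine Finset.card_bij' (fun x _ => (x.1, P)) (fun x _ => (x.1, Q)) ?_ ?_ ?_ ?_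
        · intro x hx
          rw [Finset.mem_filter, hS] at hx
          obtain ⟨hx, rfl⟩ := hx
          simpa using hx
        · intro x hx
          simp only [Finset.mem_filter, Finset.mem_univ, true_and] at hx
          obtain ⟨hx, rfl⟩ := hx
          simpa [hS] using hx
        · intro x hx
          rw [← (Finset.mem_filter.1 hx).2]
        · intro x hx
          rw [← (Finset.mem_filter.1 hx).2]
      · intro x hx
        simp only [Finset.coe_filter, Finset.mem_univ, true_and, Set.mem_ofPred_eq] at hx
        simpa using (hCC' _ _ _ hx).2 hQ
    rw [h2, ← ENNReal.ofReal_natCast, ← ENNReal.ofReal_mul (by positivity)]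
    congr 1
    field_simp
  · rw [Finset.sum_eq_zero, mul_zero]
    intro P hP
    rw [Set.Finite.mem_toFinset] at hP
    obtain ⟨h, h2⟩ := hstep P hP
    rw [h2, switchOrRestart_run, Finset.card_eq_zero.2, Nat.cast_zero, zero_mul]
    refine Finset.filter_eq_empty_iff.2 fun x hx hxQ => hQ ?_
    rw [← hxQ]
    exact (hCC' _ _ _ ((hS _ _).1 hx)).1 hP

theorem stepMapsUniform_loop (hM : 100 * maxDeg k ^ 3 < degSum k) {mL : ℕ → ℕ → ℝ} {mD : ℕ → ℝ}
    (h : AreLowerBounds k mL mD) {l d : ℕ} (hne : (goodWith k (l + 1) d).Nonempty) :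
    StepMapsUniform mL mD (goodWith k (l + 1) d) (goodWith k l d) := by
  obtain ⟨P₀, hP₀⟩ := hne
  obtain ⟨h1, h2⟩ := h.loop_of_mem hP₀
  refine stepMapsUniform_of_switching (fun P Q s => IsLoopSwitching P Q s) loopSwitchings
    (fun P x => by simp [loopSwitchings]) bLoop (fun Q => rfl) _ _
    (fun P Q s hs => hs.mem_goodWith_iff l d) ⟨P₀, hP₀⟩ (mL l d) (upperLoop k (l + 1)) h1 h2 ?_ ?_
  · rintro P ⟨-, hl, -⟩
    rw [← hl]
    exact_mod_cast fLoop_le P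
  · rintro P ⟨hg, hl, hd⟩
    have hpos : 0 < numLoops P := by omega
    have hS : (loopSwitchings P).Nonempty := Finset.card_pos.1 (fLoop_pos_of_large hM hg hpos)
    refine ⟨hS, ?_⟩
    simp only [step, if_pos (Nat.add_one_pos _), loopStep, dif_pos hS, switchOrRestart, qLoop, hl, hd, fLoop,
      Nat.add_sub_cancel]

theorem stepMapsUniform_double (hM : 100 * maxDeg k ^ 3 < degSum k) {mL : ℕ → ℕ → ℝ} {mD : ℕ → ℝ}
    (h : AreLowerBounds k mL mD) {d : ℕ} (hne : (goodWith k 0 (d + 1)).Nonempty) :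
    StepMapsUniform mL mD (goodWith k 0 (d + 1)) (goodWith k 0 d) := by
  obtain ⟨P₀, hP₀⟩ := hne
  obtain ⟨h1, h2⟩ := h.double_of_mem hP₀
  refine stepMapsUniform_of_switching (fun P Q s => IsDoubleSwitching P Q s) doubleSwitchings
    (fun P x => by simp [doubleSwitchings]) bDouble (fun Q => rfl) _ _
    (fun P Q s hs => hs.mem_goodWith_iff d) ⟨P₀, hP₀⟩ (mD d) (upperDouble k (d + 1)) h1 h2 ?_ ?_
  · rintro P ⟨-, -, hd⟩
    rw [← hd]
    exact_mod_cast fDouble_le P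
  · rintro P ⟨hg, hl, hd⟩
    have hpos : 0 < numDoubles P := by omega
    have hS : (doubleSwitchings P).Nonempty := Finset.card_pos.1 (fDouble_pos_of_large hM hg hpos)
    refine ⟨hS, ?_⟩
    simp only [step, if_pos (Nat.add_one_pos _), doubleStep, dif_pos hS, switchOrRestart, qDouble, hl, hd, fDouble,
      Nat.add_sub_cancel, lt_irrefl, if_false]

end Uniformity

/-! ### Simple configurations over a graph, and their number. -/

section SimpleConfigurations

variable {n : ℕ} {k : Fin n → ℕ}

/-- The configurations which shrink to the simple graph `G` without losing loops or multiplicities. -/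
def simpleOver (k : Fin n → ℕ) (G : SimpleGraph (Fin n)) : Set (Configuration k) :=
  {P | numLoops P = 0 ∧ numDoubles P = 0 ∧ toGraph P = G}

theorem ne_partner_cell_of_numLoops {P : Configuration k} (h : numLoops P = 0) (p : Point k) :
    p.1 ≠ (P.1 p).1 := by
  intro hp
  have h' := card_loopPoints P
  rw [h, mul_zero, Finset.card_eq_zero] at h'
  exact absurd (mem_loopPoints.2 hp) (by simp [h'])

theorem mult_le_one_of_numDoubles {P : Configuration k} (h : numDoubles P = 0) {u v : Fin n}
    (huv : u ≠ v) : mult P u v ≤ 1 := by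
  have key : ∀ u v : Fin n, u < v → mult P u v ≤ 1 := by
    intro u v huv
    have h1 := Finset.sum_eq_zero_iff.1 h u (Finset.mem_univ u)
    have h2 := Finset.sum_eq_zero_iff.1 h1 v (by simpa using huv)
    rw [Nat.choose_eq_zero_iff] at h2
    omega
  rcases lt_or_gt_of_ne huv with h1 | h1
  · exact key u v h1
  · rw [mult_comm]; exact key v u h1

theorem eq_of_partner_cell_eq {P : Configuration k} (hl : numLoops P = 0) (hd : numDoubles P = 0)
    {p q : Point k} (h : p.1 = q.1) (h' : (P.1 p).1 = (P.1 q).1) : p = q := by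
  have h1 := mult_le_one_of_numDoubles hd (ne_partner_cell_of_numLoops hl p)
  exact Finset.card_le_one.1 h1 p (by simp) q (by simp [h, h'])

theorem isGood_of_simple {P : Configuration k} (hl : numLoops P = 0) (hd : numDoubles P = 0) :
    IsGood P where
  loopsAt_le_one v := by
    have := Finset.sum_eq_zero_iff.1 hl v (Finset.mem_univ v)
    omega
  no_triple u v huv := (mult_le_one_of_numDoubles hd huv).trans one_le_two
  numLoops_le := by rw [hl, Nat.cast_zero]; exact loopCap_nonneg k
  numDoubles_le := by rw [hd, Nat.cast_zero, doubleCap_eq]; exact sq_nonneg _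

theorem toGraph_adj {P : Configuration k} (hl : numLoops P = 0) {u v : Fin n} :
    (toGraph P).Adj u v ↔ ∃ p : Point k, p.1 = u ∧ (P.1 p).1 = v := by
  rw [toGraph, SimpleGraph.fromRel_adj]
  constructor
  · rintro ⟨-, h | ⟨p, h1, h2⟩⟩
    · exact h
    · exact ⟨P.1 p, h2, by rw [P.2.1]; exact h1⟩
  · rintro ⟨p, rfl, rfl⟩
    exact ⟨ne_partner_cell_of_numLoops hl p, Or.inl ⟨p, rfl, rfl⟩⟩

/-- Without double pairs distinct points of a cell have partners in distinct cells, so the points of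
`v` label its neighbors. -/
theorem bijective_neighbors {P : Configuration k} (hl : numLoops P = 0) (hd : numDoubles P = 0)
    (v : Fin n) : Function.Bijective fun i : Fin (k v) =>
      (⟨(P.1 ⟨v, i⟩).1, (toGraph_adj hl).2 ⟨⟨v, i⟩, rfl, rfl⟩⟩ : (toGraph P).neighborSet v) := by
  constructor
  · intro i j hij
    have := eq_of_partner_cell_eq hl hd (p := ⟨v, i⟩) (q := ⟨v, j⟩) rfl (congrArg Subtype.val hij)
    simpa using this
  · rintro ⟨w, hw⟩
    obtain ⟨⟨v', i⟩, rfl, h⟩ := (toGraph_adj hl).1 hw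
    exact ⟨i, Subtype.ext h⟩

theorem toGraph_mem_graphsWithDegrees {P : Configuration k} (hl : numLoops P = 0)
    (hd : numDoubles P = 0) : toGraph P ∈ graphsWithDegrees k := by
  intro v
  rw [← Nat.card_coe_set_eq, ← Nat.card_eq_of_bijective _ (bijective_neighbors hl hd v),
    Nat.card_fin]

/-- The partner of a point in the configuration over `G` given by a labelling of the neighbors of
every vertex. -/
def labelPartner (G : SimpleGraph (Fin n)) (σ : ∀ v, Fin (k v) ≃ G.neighborSet v) (p : Point k) :
    Point k :=
  ⟨(σ p.1 p.2).1, (σ (σ p.1 p.2).1).symm ⟨p.1, (σ p.1 p.2).2.symm⟩⟩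

/-- The partner of `p` is the point of the neighboring cell whose label is the cell of `p`. This
criterion avoids computing with dependent pairs. -/
theorem labelPartner_eq {G : SimpleGraph (Fin n)} {σ : ∀ v, Fin (k v) ≃ G.neighborSet v}
    {p q : Point k} (h : (σ p.1 p.2).1 = q.1) (h' : (σ q.1 q.2).1 = p.1) :
    labelPartner G σ p = q := by
  obtain ⟨w, j⟩ := q
  simp only at h h'
  subst h
  have : (σ (σ p.1 p.2).1).symm ⟨p.1, (σ p.1 p.2).2.symm⟩ = j :=
    (Equiv.symm_apply_eq _).2 (Subtype.ext h'.symm)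
  rw [labelPartner, this]

theorem label_labelPartner {G : SimpleGraph (Fin n)} {σ : ∀ v, Fin (k v) ≃ G.neighborSet v}
    (p : Point k) : (σ (labelPartner G σ p).1 (labelPartner G σ p).2).1 = p.1 :=
  congrArg Subtype.val ((σ (σ p.1 p.2).1).apply_symm_apply ⟨p.1, (σ p.1 p.2).2.symm⟩)

/-- The configuration over `G` given by a labelling of the neighbors of every vertex. -/
def ofLabelling (G : SimpleGraph (Fin n)) (σ : ∀ v, Fin (k v) ≃ G.neighborSet v) :
    Configuration k :=
  ⟨labelPartner G σ, fun p => labelPartner_eq (label_labelPartner p) rfl,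
    fun p h => (σ p.1 p.2).2.ne (congrArg Sigma.fst h).symm⟩

theorem ofLabelling_cell {G : SimpleGraph (Fin n)} {σ : ∀ v, Fin (k v) ≃ G.neighborSet v}
    (p : Point k) : ((ofLabelling G σ).1 p).1 = (σ p.1 p.2).1 := rfl

theorem ofLabelling_mem (G : SimpleGraph (Fin n)) (σ : ∀ v, Fin (k v) ≃ G.neighborSet v) :
    ofLabelling G σ ∈ simpleOver k G := by
  have hl : numLoops (ofLabelling G σ) = 0 := by
    have h : loopPoints (ofLabelling G σ) = ∅ := by
      refine Finset.eq_empty_of_forall_notMem fun p hp => ?_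
      rw [mem_loopPoints, ofLabelling_cell] at hp
      exact (σ p.1 p.2).2.ne hp
    have := card_loopPoints (ofLabelling G σ)
    rw [h, Finset.card_empty] at this
    omega
  refine ⟨hl, ?_, ?_⟩
  · refine Finset.sum_eq_zero fun u _ => Finset.sum_eq_zero fun v _ => ?_
    refine Nat.choose_eq_zero_of_lt (Nat.lt_succ_of_le ?_)
    rw [mult, Finset.card_le_one]
    rintro ⟨v₁, i⟩ h₁ ⟨v₂, j⟩ h₂
    obtain ⟨-, rfl, g₁⟩ := Finset.mem_filter.1 h₁
    obtain ⟨-, rfl, g₂⟩ := Finset.mem_filter.1 h₂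
    exact congrArg (Sigma.mk v₂) ((σ v₂).injective (Subtype.ext (g₁.trans g₂.symm)))
  · ext u v
    rw [toGraph_adj hl]
    constructor
    · rintro ⟨p, rfl, rfl⟩
      exact (σ p.1 p.2).2
    · intro huv
      refine ⟨⟨u, (σ u).symm ⟨v, huv⟩⟩, rfl, ?_⟩
      rw [ofLabelling_cell]
      simp

/-- A simple configuration over `G` amounts to a labelling: each point is labelled by the cell of
its partner, and conversely the labels determine the partners. -/
theorem ncard_simpleOver (G : SimpleGraph (Fin n)) :
    (simpleOver k G).ncard = Nat.card (∀ v, Fin (k v) ≃ G.neighborSet v) := by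
  rw [← Nat.card_coe_set_eq]
  refine (Nat.card_eq_of_bijective (fun σ => ⟨ofLabelling G σ, ofLabelling_mem G σ⟩) ⟨?_, ?_⟩).symm
  · intro σ τ h
    funext v
    ext i
    have h1 : ofLabelling G σ = ofLabelling G τ := congrArg Subtype.val h
    have h2 := congrArg (fun P : Configuration k => (P.1 ⟨v, i⟩).1) h1
    exact congrArg Fin.val h2
  · rintro ⟨P, hl, hd, rfl⟩
    refine ⟨fun v => Equiv.ofBijective _ (bijective_neighbors hl hd v), ?_⟩
    apply Subtype.ext
    apply Subtype.ext
    funext p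
    refine labelPartner_eq (σ := fun v => Equiv.ofBijective _ (bijective_neighbors hl hd v)) rfl ?_
    exact congrArg Sigma.fst (P.2.1 p)

theorem card_labellings {G : SimpleGraph (Fin n)} (hG : G ∈ graphsWithDegrees k) :
    Nat.card (∀ v, Fin (k v) ≃ G.neighborSet v) = ∏ v, (k v).factorial := by
  rw [Nat.card_pi]
  refine Finset.prod_congr rfl fun v _ => ?_
  have e : Nonempty (Fin (k v) ≃ G.neighborSet v) :=
    (Finite.card_eq (α := Fin (k v))).1 (by rw [Nat.card_fin, Nat.card_coe_set_eq, hG v])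
  obtain ⟨e⟩ := e
  rw [Nat.card_congr (Equiv.equivCongr (Equiv.refl (Fin (k v))) e.symm)]
  simp [Nat.card_eq_fintype_card, Fintype.card_perm]

theorem ncard_simpleOver_of_mem {G : SimpleGraph (Fin n)} (hG : G ∈ graphsWithDegrees k) :
    (simpleOver k G).ncard = ∏ v, (k v).factorial := by
  rw [ncard_simpleOver, card_labellings hG]

theorem simpleOver_nonempty {G : SimpleGraph (Fin n)} (hG : G ∈ graphsWithDegrees k) :
    (simpleOver k G).Nonempty := by
  apply Set.nonempty_of_ncard_ne_zero
  rw [ncard_simpleOver_of_mem hG]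
  exact Finset.prod_ne_zero_iff.2 fun v _ => (Nat.factorial_pos _).ne'

end SimpleConfigurations

/-! ### The Markov chain: transition probabilities and symmetry of its law. -/

section Chain

variable {n : ℕ} {k : Fin n → ℕ}

theorem switchOrRestart_support {ι : Type*} {S : Finset (ι × Configuration k)} (h : S.Nonempty)
    (q : Configuration k → ℝ) {s : State k} (hs : s ∈ (switchOrRestart S h q).support) :
    s = .start ∨ ∃ x ∈ S, s = .run x.2 := by
  rw [switchOrRestart, PMF.mem_support_bind_iff] at hs
  obtain ⟨x, hx, hs⟩ := hs
  rw [PMF.mem_support_map_iff] at hs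
  obtain ⟨r, -, rfl⟩ := hs
  rw [PMF.mem_support_uniformOfFinset_iff] at hx
  cases r
  · exact Or.inr ⟨x, hx, by simp⟩
  · exact Or.inl (by simp)

/-- From a running configuration which is not simple, the algorithm either restarts or proceeds to a
good configuration with one loop or one double pair less. -/
theorem step_run_support {mL : ℕ → ℕ → ℝ} {mD : ℕ → ℝ} {P : Configuration k}
    (hP : 0 < numLoops P + numDoubles P) {s : State k}
    (hs : s ∈ (step mL mD (.run P)).support) :
    s = .start ∨ ∃ Q, IsGood Q ∧ numLoops P + numDoubles P = numLoops Q + numDoubles Q + 1 ∧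
      s = .run Q := by
  rw [step] at hs
  split_ifs at hs with h1 h2
  · rw [loopStep] at hs
    split_ifs at hs with h3
    · refine (switchOrRestart_support h3 (qLoop mL P) hs).imp_right ?_
      rintro ⟨x, hx, rfl⟩
      obtain ⟨e1, e2, e3⟩ := IsLoopSwitching.effect (by simpa [loopSwitchings] using hx)
      exact ⟨x.2, e3, by omega, rfl⟩
    · exact Or.inl (by simpa using hs)
  · rw [doubleStep] at hs
    split_ifs at hs with h3
    · refine (switchOrRestart_support h3 (qDouble mD P) hs).imp_right ?_
      rintro ⟨x, hx, rfl⟩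
      obtain ⟨e1, e2, e3⟩ := IsDoubleSwitching.effect (by simpa [doubleSwitchings] using hx)
      exact ⟨x.2, e3, by omega, rfl⟩
    · exact Or.inl (by simpa using hs)
  · omega

theorem step_run_simple {mL : ℕ → ℕ → ℝ} {mD : ℕ → ℝ} {P : Configuration k}
    (hP : numLoops P + numDoubles P = 0) :
    step mL mD (.run P) = PMF.pure (.done (toGraph P)) := by
  rw [step, if_neg (by omega), if_neg (by omega)]

theorem step_run_run_eq_zero {mL : ℕ → ℕ → ℝ} {mD : ℕ → ℝ} (P : Configuration k)
    {Q : Configuration k} (hQ : ¬ IsGood Q) : step mL mD (.run P) (.run Q) = 0 := by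
  rcases Nat.eq_zero_or_pos (numLoops P + numDoubles P) with h | h
  · rw [step_run_simple h, PMF.pure_apply, if_neg (by simp)]
  · by_contra hne
    rcases step_run_support h ((PMF.mem_support_iff _ _).2 hne) with h1 | ⟨Q', h1, -, h2⟩
    · simp at h1
    · simp only [State.run.injEq] at h2
      exact hQ (h2 ▸ h1)

open Classical in
theorem step_run_done {mL : ℕ → ℕ → ℝ} {mD : ℕ → ℝ} (P : Configuration k)
    (G : SimpleGraph (Fin n)) :
    step mL mD (.run P) (.done G) = if P ∈ simpleOver k G then 1 else 0 := by
  rcases Nat.eq_zero_or_pos (numLoops P + numDoubles P) with h | h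
  · rw [step_run_simple h, PMF.pure_apply]
    have h1 : numLoops P = 0 := by omega
    have h2 : numDoubles P = 0 := by omega
    simp [simpleOver, h1, h2, eq_comm]
  · rw [if_neg]
    · by_contra hne
      rcases step_run_support h ((PMF.mem_support_iff _ _).2 hne) with h1 | ⟨Q', h1, -, h2⟩
      · simp at h1
      · simp at h2
    · rintro ⟨h1, h2, -⟩
      omega

open Classical in
theorem initialStep_of_nonempty [Nonempty (Configuration k)] :
    initialStep k = (PMF.uniformOfFintype (Configuration k)).map
      fun P => if IsGood P then State.run P else .start := by
  rw [initialStep, dif_pos Finset.univ_nonempty]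
  rfl

open Classical in
theorem initialStep_run [Nonempty (Configuration k)] (Q : Configuration k) :
    initialStep k (.run Q) =
      if IsGood Q then (Fintype.card (Configuration k) : ℝ≥0∞)⁻¹ else 0 := by
  rw [initialStep_of_nonempty, PMF.map_apply, tsum_fintype]
  split_ifs with h
  · rw [Finset.sum_eq_single Q]
    · simp [h]
    · intro P _ hP
      rw [if_neg]
      split_ifs <;> simp [hP.symm]
    · simp
  · refine Finset.sum_eq_zero fun P _ => ?_
    rw [if_neg]
    split_ifs with h1
    · simp only [State.run.injEq]
      rintro rfl
      exact h h1
    · simp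

theorem initialStep_done [Nonempty (Configuration k)] (G : SimpleGraph (Fin n)) :
    initialStep k (.done G) = 0 := by
  classical
  rw [initialStep_of_nonempty, PMF.map_apply, tsum_fintype]
  refine Finset.sum_eq_zero fun P _ => ?_
  rw [if_neg]
  split_ifs <;> simp

/-- The states are the disjoint union of the initial state, the configurations and the graphs. -/
def stateEquiv (k : Fin n → ℕ) : State k ≃ Unit ⊕ Configuration k ⊕ SimpleGraph (Fin n) where
  toFun
    | .start => .inl ()
    | .run P => .inr (.inl P)
    | .done G => .inr (.inr G)
  invFun
    | .inl _ => .start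
    | .inr (.inl P) => .run P
    | .inr (.inr G) => .done G
  left_inv s := by cases s <;> rfl
  right_inv s := by rcases s with _ | _ | _ <;> rfl

theorem tsum_state (f : State k → ℝ≥0∞) :
    ∑' s, f s = f .start + (∑ P, f (.run P) + ∑ G, f (.done G)) := by
  rw [← (stateEquiv k).symm.tsum_eq f, tsum_fintype, Fintype.sum_sum_type, Fintype.sum_sum_type]
  simp [stateEquiv]

theorem law_succ_run (mL : ℕ → ℕ → ℝ) (mD : ℕ → ℝ) (t : ℕ) (Q : Configuration k) :
    law k mL mD (t + 1) (.run Q) = law k mL mD t .start * initialStep k (.run Q) +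
      ∑ P, law k mL mD t (.run P) * step mL mD (.run P) (.run Q) := by
  rw [law, PMF.bind_apply, tsum_state]
  simp [step]

theorem law_succ_done [Nonempty (Configuration k)] (mL : ℕ → ℕ → ℝ) (mD : ℕ → ℝ) (t : ℕ)
    (G : SimpleGraph (Fin n)) :
    law k mL mD (t + 1) (.done G) = law k mL mD t (.done G) +
      ∑ P ∈ (simpleOver k G).toFinite.toFinset, law k mL mD t (.run P) := by
  classical
  rw [law, PMF.bind_apply, tsum_state, step, initialStep_done, mul_zero, zero_add, add_comm]
  congr 1
  · rw [Finset.sum_eq_single G]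
    · simp [step]
    · intro G' _ hG'
      simp [step, hG'.symm]
    · simp
  · simp only [step_run_done, mul_ite, mul_one, mul_zero]
    rw [← Finset.sum_filter]
    congr 1
    ext P
    simp

/-! ### Uniformity of the output -/

/-- The law of the state treats configurations of the same class, and graphs with the same degrees,
alike. -/
structure IsSymmetricLaw (k : Fin n → ℕ) (p : PMF (State k)) : Prop where
  run_not_good : ∀ P, ¬ IsGood P → p (.run P) = 0
  run_eq : ∀ l d, ∀ P ∈ goodWith k l d, ∀ P' ∈ goodWith k l d, p (.run P) = p (.run P')
  done_eq_zero : ∀ G ∉ graphsWithDegrees k, p (.done G) = 0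
  done_eq : ∀ G ∈ graphsWithDegrees k, ∀ G' ∈ graphsWithDegrees k, p (.done G) = p (.done G')

theorem StepMapsUniform.sum_eq {mL : ℕ → ℕ → ℝ} {mD : ℕ → ℝ} {C C' : Set (Configuration k)}
    (h : StepMapsUniform mL mD C C') (hC : C.Nonempty) {Q Q' : Configuration k}
    (hQ : Q ∈ C' ↔ Q' ∈ C') :
    ∑ P ∈ C.toFinite.toFinset, step mL mD (.run P) (.run Q) =
      ∑ P ∈ C.toFinite.toFinset, step mL mD (.run P) (.run Q') := by
  obtain ⟨-, a, -, h⟩ := h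
  have h0 : (C.ncard : ℝ≥0∞)⁻¹ ≠ 0 := ENNReal.inv_ne_zero.2 (ENNReal.natCast_ne_top _)
  have h1 : (C.ncard : ℝ≥0∞)⁻¹ ≠ ∞ := by
    rw [ENNReal.inv_ne_top, Nat.cast_ne_zero]
    exact (Set.ncard_pos C.toFinite).2 hC |>.ne'
  refine (ENNReal.mul_right_inj h0 h1).1 ?_
  by_cases hQC : Q ∈ C'
  · rw [(h Q).1 hQC, (h Q').1 (hQ.1 hQC)]
  · rw [(h Q).2 hQC, (h Q').2 (fun h' => hQC (hQ.2 h'))]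

/-- The total flow from one class into a configuration depends only on the class of the target. From
C_{0,0} it vanishes, since the algorithm stops there. -/
theorem sum_step_eq (hM : 100 * maxDeg k ^ 3 < degSum k) {mL : ℕ → ℕ → ℝ} {mD : ℕ → ℝ}
    (h : AreLowerBounds k mL mD) {l d : ℕ} {Q Q' : Configuration k} (hQ : Q ∈ goodWith k l d)
    (hQ' : Q' ∈ goodWith k l d) (l' d' : ℕ) :
    ∑ P ∈ (goodWith k l' d').toFinite.toFinset, step mL mD (.run P) (.run Q) =
      ∑ P ∈ (goodWith k l' d').toFinite.toFinset, step mL mD (.run P) (.run Q') := by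
  have hiff : ∀ l₁ d₁, Q ∈ goodWith k l₁ d₁ ↔ Q' ∈ goodWith k l₁ d₁ := by
    intro l₁ d₁
    obtain ⟨h1, h2, h3⟩ := hQ
    obtain ⟨i1, i2, i3⟩ := hQ'
    simp only [goodWith, Set.mem_ofPred_eq, h1, h2, h3, i1, i2, i3]
  rcases (goodWith k l' d').eq_empty_or_nonempty with he | hne
  · simp [he]
  rcases l' with _ | l'
  · rcases d' with _ | d'
    · refine Finset.sum_congr rfl fun P hP => ?_
      rw [Set.Finite.mem_toFinset] at hP
      obtain ⟨-, h1, h2⟩ := hP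
      rw [step_run_simple (by omega), PMF.pure_apply, PMF.pure_apply, if_neg (by simp),
        if_neg (by simp)]
    · exact (stepMapsUniform_double hM h hne).sum_eq hne (hiff _ _)
  · exact (stepMapsUniform_loop hM h hne).sum_eq hne (hiff _ _)

/-- By induction, the running part of the law is a mixture of uniform measures on the classes, and a
step sends each of them to a measure constant on classes. Fresh draws after a restart are equally
likely for all good configurations. -/
theorem isSymmetricLaw_law [Nonempty (Configuration k)] (hM : 100 * maxDeg k ^ 3 < degSum k)
    {mL : ℕ → ℕ → ℝ} {mD : ℕ → ℝ} (h : AreLowerBounds k mL mD) (t : ℕ) :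
    IsSymmetricLaw k (law k mL mD t) := by
  classical
  induction t with
  | zero => constructor <;> simp [law]
  | succ t ih =>
    constructor
    · intro Q hQ
      rw [law_succ_run, initialStep_run, if_neg hQ]
      simp [step_run_run_eq_zero _ hQ]
    · intro l d Q hQ Q' hQ'
      rw [law_succ_run, law_succ_run, initialStep_run, initialStep_run, if_pos hQ.1, if_pos hQ'.1]
      congr 1
      -- The predecessors are grouped by class; those that are not good carry no mass.
      have key : ∀ R : Configuration k,
          ∑ P, law k mL mD t (.run P) * step mL mD (.run P) (.run R) =
          ∑ c ∈ (Finset.univ.filter fun P : Configuration k => IsGood P).image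
              (fun P => (numLoops P, numDoubles P)),
            ∑ P ∈ (goodWith k c.1 c.2).toFinite.toFinset,
              law k mL mD t (.run P) * step mL mD (.run P) (.run R) := by
        intro R
        rw [← Finset.sum_filter_of_ne (p := fun P => IsGood P),
          ← Finset.sum_fiberwise_of_maps_to (s := Finset.univ.filter fun P => IsGood P)
            (g := fun P => (numLoops P, numDoubles P)) (fun P hP => Finset.mem_image_of_mem _ hP)]
        · refine Finset.sum_congr rfl fun c _ => Finset.sum_congr ?_ fun _ _ => rfl
          ext P
          simp [goodWith, Prod.ext_iff]
        · intro P _ hP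
          by_contra hg
          exact hP (by rw [ih.run_not_good P hg, zero_mul])
      rw [key Q, key Q']
      refine Finset.sum_congr rfl fun c hc => ?_
      obtain ⟨P₀, hP₀, rfl⟩ := Finset.mem_image.1 hc
      have hP₀' : P₀ ∈ goodWith k (numLoops P₀) (numDoubles P₀) :=
        ⟨(Finset.mem_filter.1 hP₀).2, rfl, rfl⟩
      have hconst : ∀ R : Configuration k,
          ∑ P ∈ (goodWith k (numLoops P₀) (numDoubles P₀)).toFinite.toFinset,
            law k mL mD t (.run P) * step mL mD (.run P) (.run R) =
          law k mL mD t (.run P₀) *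
            ∑ P ∈ (goodWith k (numLoops P₀) (numDoubles P₀)).toFinite.toFinset,
              step mL mD (.run P) (.run R) := by
        intro R
        rw [Finset.mul_sum]
        refine Finset.sum_congr rfl fun P hP => ?_
        rw [Set.Finite.mem_toFinset] at hP
        rw [ih.run_eq _ _ P hP P₀ hP₀']
      rw [hconst, hconst, sum_step_eq hM h hQ hQ']
    · intro G hG
      rw [law_succ_done, ih.done_eq_zero G hG, zero_add]
      refine Finset.sum_eq_zero fun P hP => ?_
      rw [Set.Finite.mem_toFinset] at hP
      obtain ⟨h1, h2, rfl⟩ := hP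
      exact absurd (toGraph_mem_graphsWithDegrees h1 h2) hG
    · intro G hG G' hG'
      rw [law_succ_done, law_succ_done, ih.done_eq G hG G' hG']
      congr 1
      obtain ⟨P₀, hP₀⟩ := simpleOver_nonempty hG
      have hmem : ∀ {G₁ : SimpleGraph (Fin n)} {P : Configuration k}, P ∈ simpleOver k G₁ →
          P ∈ goodWith k 0 0 := fun hP => ⟨isGood_of_simple hP.1 hP.2.1, hP.1, hP.2.1⟩
      -- Newly finished mass: each graph has ∏ k_v! simple configurations, all in C_{0,0} and hence
      -- equally likely.
      have hconst : ∀ G₁ ∈ graphsWithDegrees k,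
          ∑ P ∈ (simpleOver k G₁).toFinite.toFinset, law k mL mD t (.run P) =
            (∏ v, (k v).factorial) • law k mL mD t (.run P₀) := by
        intro G₁ hG₁
        rw [← ncard_simpleOver_of_mem hG₁, Set.ncard_eq_toFinset_card _ (Set.toFinite _),
          ← Finset.sum_const]
        refine Finset.sum_congr rfl fun P hP => ?_
        rw [Set.Finite.mem_toFinset] at hP
        exact ih.run_eq 0 0 P (hmem hP) P₀ (hmem hP₀)
      rw [hconst G hG, hconst G' hG']

end Chain

/-! ### Termination by a potential function, and the output law. -/

section Termination

variable {n : ℕ} {k : Fin n → ℕ}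

/-- The expectation of a function on a discrete probability space. -/
noncomputable def expect {α : Type*} (p : PMF α) (V : α → ℝ≥0∞) : ℝ≥0∞ := ∑' a, p a * V a

theorem expect_pure {α : Type*} (a : α) (V : α → ℝ≥0∞) : expect (PMF.pure a) V = V a := by
  rw [expect, tsum_eq_single a]
  · simp
  · intro b hb
    simp [hb]

theorem expect_bind {α β : Type*} (p : PMF α) (f : α → PMF β) (V : β → ℝ≥0∞) :
    expect (p.bind f) V = expect p fun a => expect (f a) V := by
  simp only [expect, PMF.bind_apply, ← ENNReal.tsum_mul_right, ← ENNReal.tsum_mul_left]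
  rw [ENNReal.tsum_comm]
  simp only [mul_assoc]

theorem expect_map {α β : Type*} (p : PMF α) (f : α → β) (V : β → ℝ≥0∞) :
    expect (p.map f) V = expect p fun a => V (f a) := by
  rw [PMF.map, expect_bind]
  simp only [Function.comp_apply, expect_pure]

theorem expect_add {α : Type*} (p : PMF α) (V W : α → ℝ≥0∞) :
    expect p (fun a => V a + W a) = expect p V + expect p W := by
  simp only [expect, mul_add, ENNReal.tsum_add]

theorem expect_mono {α : Type*} (p : PMF α) {V W : α → ℝ≥0∞} (h : ∀ a, V a ≤ W a) :
    expect p V ≤ expect p W :=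
  ENNReal.tsum_le_tsum fun a => by gcongr; exact h a

theorem expect_le_of_support {α : Type*} (p : PMF α) {V : α → ℝ≥0∞} {c : ℝ≥0∞}
    (h : ∀ a ∈ p.support, V a ≤ c) : expect p V ≤ c := by
  calc expect p V ≤ ∑' a, p a * c := ENNReal.tsum_le_tsum fun a => by
        by_cases ha : p a = 0
        · simp [ha]
        · gcongr
          exact h a ((PMF.mem_support_iff _ _).2 ha)
    _ = c := by rw [ENNReal.tsum_mul_right, p.tsum_coe, one_mul]

/-- The indicator of the event that the algorithm has not terminated. -/
def notDone : State k → ℝ≥0∞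
  | .done _ => 0
  | _ => 1

/-- The largest number of loops and double pairs of a configuration. -/
def maxDefects (k : Fin n → ℕ) : ℕ :=
  Finset.univ.sup fun P : Configuration k => numLoops P + numDoubles P

/-- The value of the potential function at the initial state. -/
def startPotential (k : Fin n → ℕ) : ℕ :=
  Fintype.card (Configuration k) * (maxDefects k + 1) + 1

/-- A function of the state whose expectation drops by one in every step until the algorithm
terminates. -/
def potential : State k → ℕ
  | .start => startPotential k
  | .run P => if numLoops P + numDoubles P = 0 then 1 else
      startPotential k + (numLoops P + numDoubles P)
  | .done _ => 0

/-- The drop is deterministic here: a restart discards the positive number of defects, an accepted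
switching removes one of them, and a simple configuration passes from 1 to 0. -/
theorem expect_step_run (mL : ℕ → ℕ → ℝ) (mD : ℕ → ℝ) (P : Configuration k) :
    expect (step mL mD (.run P)) (fun s => (potential s : ℝ≥0∞)) + 1 ≤
      potential (.run P) := by
  rcases Nat.eq_zero_or_pos (numLoops P + numDoubles P) with h | h
  · rw [step_run_simple h, expect_pure]
    simp [potential, h]
  · have h1 : expect (step mL mD (.run P)) (fun s => (potential s : ℝ≥0∞)) ≤
        ((startPotential k + (numLoops P + numDoubles P) - 1 : ℕ) : ℝ≥0∞) := by
      refine expect_le_of_support _ fun s hs => ?_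
      rw [Nat.cast_le]
      rcases step_run_support h hs with rfl | ⟨Q, -, hQ, rfl⟩
      · rw [potential]
        omega
      · have : 0 < startPotential k := Nat.succ_pos _
        rw [potential]
        split_ifs <;> omega
    refine (add_le_add_left h1 1).trans ?_
    have h2 : startPotential k + (numLoops P + numDoubles P) - 1 + 1 ≤ potential (.run P) := by
      rw [potential, if_neg h.ne']
      omega
    exact_mod_cast h2

/-- The simple configuration `P₀` has potential 1, and this gain pays for all the others, which lie
at most `maxDefects k` above the starting value. -/
theorem expect_initialStep {P₀ : Configuration k} (hP₀ : numLoops P₀ + numDoubles P₀ = 0) :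
    expect (initialStep k) (fun s => (potential s : ℝ≥0∞)) + 1 ≤ startPotential k := by
  classical
  have : Nonempty (Configuration k) := ⟨P₀⟩
  have hg : IsGood P₀ := isGood_of_simple (by omega) (by omega)
  have hN : (Fintype.card (Configuration k) : ℝ≥0∞) ≠ 0 := by
    rw [Nat.cast_ne_zero]
    exact Fintype.card_ne_zero
  have hN' : (Fintype.card (Configuration k) : ℝ≥0∞) ≠ ∞ := ENNReal.natCast_ne_top _
  set g : Configuration k → ℕ := fun P =>
    potential (if IsGood P then State.run P else State.start) with hgdef
  -- With N configurations, at most D defects and starting value S, the claim is 1 + (N-1)(S + D) +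
  -- N ≤ N·S, that is, S ≥ 1 + N + (N-1)D. The choice S = N(D+1) + 1 satisfies it.
  have key : ∑ P, g P + Fintype.card (Configuration k) ≤
      Fintype.card (Configuration k) * startPotential k := by
    have h1 : ∀ P ∈ Finset.univ.erase P₀, g P ≤ startPotential k + maxDefects k := by
      intro P _
      have : numLoops P + numDoubles P ≤ maxDefects k :=
        Finset.le_sup (f := fun P : Configuration k => numLoops P + numDoubles P)
          (Finset.mem_univ P)
      have : 0 < startPotential k := Nat.succ_pos _
      simp only [hgdef]
      split_ifs
      · rw [potential]
        split_ifs <;> omega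
      · rw [potential]
        omega
    have h2 := Finset.sum_le_card_nsmul _ _ _ h1
    have h3 : g P₀ = 1 := by
      simp only [hgdef, if_pos hg, potential, if_pos hP₀]
    rw [← Finset.add_sum_erase _ _ (Finset.mem_univ P₀), h3]
    rw [Finset.card_erase_of_mem (Finset.mem_univ _), Finset.card_univ, smul_eq_mul] at h2
    obtain ⟨m, hm⟩ := Nat.exists_eq_succ_of_ne_zero (Fintype.card_ne_zero (α := Configuration k))
    rw [startPotential] at h2 ⊢
    rw [hm, Nat.succ_eq_add_one] at h2 ⊢
    rw [Nat.add_sub_cancel] at h2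
    nlinarith
  have h4 : expect (initialStep k) (fun s => (potential s : ℝ≥0∞)) =
      (Fintype.card (Configuration k) : ℝ≥0∞)⁻¹ * ((∑ P, g P : ℕ) : ℝ≥0∞) := by
    rw [initialStep_of_nonempty, expect_map, expect, tsum_fintype, Nat.cast_sum, Finset.mul_sum]
    simp [hgdef]
  rw [h4]
  calc _ = (Fintype.card (Configuration k) : ℝ≥0∞)⁻¹ *
        ((∑ P, g P + Fintype.card (Configuration k) : ℕ) : ℝ≥0∞) := by
        rw [Nat.cast_add, mul_add, ENNReal.inv_mul_cancel hN hN']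
    _ ≤ (Fintype.card (Configuration k) : ℝ≥0∞)⁻¹ *
        ((Fintype.card (Configuration k) * startPotential k : ℕ) : ℝ≥0∞) := by
        gcongr
    _ = startPotential k := by
        rw [Nat.cast_mul, ← mul_assoc, ENNReal.inv_mul_cancel hN hN', one_mul]

theorem expect_step {P₀ : Configuration k} (hP₀ : numLoops P₀ + numDoubles P₀ = 0)
    (mL : ℕ → ℕ → ℝ) (mD : ℕ → ℝ) (s : State k) :
    expect (step mL mD s) (fun s => (potential s : ℝ≥0∞)) + notDone s ≤ potential s := by
  cases s with
  | start => exact expect_initialStep hP₀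
  | run P => exact expect_step_run mL mD P
  | done G =>
    rw [step, expect_pure]
    simp [potential, notDone]

/-- Telescoping the drop of the potential bounds the expected number of steps before termination. No
property of `mL` and `mD` is needed, as the drop holds for any coins. -/
theorem sum_expect_notDone_le {P₀ : Configuration k} (hP₀ : numLoops P₀ + numDoubles P₀ = 0)
    (mL : ℕ → ℕ → ℝ) (mD : ℕ → ℝ) (t : ℕ) :
    expect (law k mL mD t) (fun s => (potential s : ℝ≥0∞)) +
      ∑ i ∈ Finset.range t, expect (law k mL mD i) notDone ≤ startPotential k := by
  induction t with
  | zero =>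
    rw [law, expect_pure]
    simp [potential]
  | succ t ih =>
    refine le_trans ?_ ih
    rw [Finset.sum_range_succ, add_comm (∑ i ∈ Finset.range t, _), ← add_assoc, law, expect_bind,
      ← expect_add]
    gcongr
    exact expect_mono _ fun s => expect_step hP₀ mL mD s

theorem tendsto_expect_notDone {P₀ : Configuration k} (hP₀ : numLoops P₀ + numDoubles P₀ = 0)
    (mL : ℕ → ℕ → ℝ) (mD : ℕ → ℝ) :
    Filter.Tendsto (fun t => expect (law k mL mD t) notDone) Filter.atTop (nhds 0) := by
  refine ENNReal.tendsto_atTop_zero_of_tsum_ne_top (ne_top_of_le_ne_top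
    (ENNReal.natCast_ne_top (startPotential k)) ?_)
  rw [ENNReal.tsum_eq_iSup_nat]
  exact iSup_le fun t => le_add_self.trans (sum_expect_notDone_le hP₀ mL mD t)

theorem sum_done_add_notDone (p : PMF (State k)) :
    ∑ G, p (.done G) + expect p notDone = 1 := by
  rw [← p.tsum_coe, expect, tsum_state, tsum_state]
  simp only [notDone, mul_one, mul_zero, Finset.sum_const_zero, add_zero]
  rw [add_comm, add_assoc]

theorem law_done_mono (mL : ℕ → ℕ → ℝ) (mD : ℕ → ℝ) (G : SimpleGraph (Fin n)) :
    Monotone fun t => law k mL mD t (.done G) := by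
  refine monotone_nat_of_le_succ fun t => ?_
  rw [law, PMF.bind_apply]
  refine le_trans (le_of_eq ?_) (ENNReal.le_tsum (State.done G))
  simp [step]

/-- There are finitely many graphs and the probabilities increase with time, so the supremum may be
taken after summation. The missing mass is the probability of not having finished, which tends to 0.
-/
theorem tsum_outputProb {P₀ : Configuration k} (hP₀ : numLoops P₀ + numDoubles P₀ = 0)
    (mL : ℕ → ℕ → ℝ) (mD : ℕ → ℝ) : ∑' G, outputProb k mL mD G = 1 := by
  rw [tsum_fintype]
  simp only [outputProb]
  rw [ENNReal.finsetSum_iSup_of_monotone fun G => law_done_mono mL mD G]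
  apply le_antisymm
  · refine iSup_le fun t => ?_
    rw [← sum_done_add_notDone (law k mL mD t)]
    exact le_self_add
  · have h1 : Filter.Tendsto (fun t => (⨆ t, ∑ G, law k mL mD t (.done G)) +
        expect (law k mL mD t) notDone) Filter.atTop
        (nhds ((⨆ t, ∑ G, law k mL mD t (.done G)) + 0)) :=
      tendsto_const_nhds.add (tendsto_expect_notDone hP₀ mL mD)
    rw [add_zero] at h1
    refine ge_of_tendsto' h1 fun t => ?_
    rw [← sum_done_add_notDone (law k mL mD t)]
    gcongr
    exact le_iSup (fun t => ∑ G, law k mL mD t (.done G)) t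

theorem outputProb_eq_zero [Nonempty (Configuration k)] (hM : 100 * maxDeg k ^ 3 < degSum k)
    {mL : ℕ → ℕ → ℝ} {mD : ℕ → ℝ} (h : AreLowerBounds k mL mD) {G : SimpleGraph (Fin n)}
    (hG : G ∉ graphsWithDegrees k) : outputProb k mL mD G = 0 := by
  simp [outputProb, fun t => (isSymmetricLaw_law hM h t).done_eq_zero G hG]

/-- The total mass 1 is carried by G(k) and shared equally among its elements. -/
theorem outputProb_eq_inv (hM : 100 * maxDeg k ^ 3 < degSum k)
    {mL : ℕ → ℕ → ℝ} {mD : ℕ → ℝ} (h : AreLowerBounds k mL mD) {G : SimpleGraph (Fin n)}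
    (hG : G ∈ graphsWithDegrees k) :
    outputProb k mL mD G = ((graphsWithDegrees k).ncard : ℝ≥0∞)⁻¹ := by
  classical
  obtain ⟨P₀, h1, h2, -⟩ := simpleOver_nonempty hG
  have : Nonempty (Configuration k) := ⟨P₀⟩
  have hsum := tsum_outputProb (P₀ := P₀) (by omega) mL mD
  rw [tsum_fintype, ← Finset.sum_filter_of_ne (p := fun G => G ∈ graphsWithDegrees k)
    (fun G' _ h' => by_contra fun hG' => h' (outputProb_eq_zero hM h hG'))] at hsum
  have hconst : ∀ G' ∈ Finset.univ.filter (fun G => G ∈ graphsWithDegrees k),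
      outputProb k mL mD G' = outputProb k mL mD G := by
    intro G' hG'
    exact iSup_congr fun t =>
      (isSymmetricLaw_law hM h t).done_eq G' (Finset.mem_filter.1 hG').2 G hG
  rw [Finset.sum_congr rfl hconst, Finset.sum_const, nsmul_eq_mul, mul_comm] at hsum
  have hcard : (Finset.univ.filter fun G => G ∈ graphsWithDegrees k).card =
      (graphsWithDegrees k).ncard := by
    rw [← Set.ncard_coe_finset]
    congr 1
    ext G'
    simp
  rw [hcard] at hsum
  exact ENNReal.eq_inv_of_mul_eq_one_left hsum

end Termination

end McKayWormald

theorem lemma4p2 (C : ℝ) :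
    ∃ M₀ : ℕ, ∀ (n : ℕ) (k : Fin n → ℕ), Graphical k →
      (maxDeg k : ℝ) ^ 4 ≤ C * degSum k → M₀ ≤ degSum k →
      -- the explicit expressions are positive lower bounds
      AreLowerBounds k (explicitLoop k) (explicitDouble k) ∧
      -- the upper bounds for the numbers of switchings, and the existence of a switching
      (∀ l d : ℕ, ∀ P ∈ goodWith k l d,
        fLoop P ≤ upperLoop k l ∧ (0 < l → 0 < fLoop P)) ∧
      (∀ d : ℕ, ∀ P ∈ goodWith k 0 d,
        fDouble P ≤ upperDouble k d ∧ (0 < d → 0 < fDouble P)) ∧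
      -- for all positive lower bounds:
      ∀ (mL : ℕ → ℕ → ℝ) (mD : ℕ → ℝ), AreLowerBounds k mL mD →
        -- the rejection probabilities are well defined, and never equal to one
        (∀ l d : ℕ, ∀ P ∈ goodWith k (l + 1) d, ∀ P' s, IsLoopSwitching P P' s →
          P' ∈ goodWith k l d ∧ 0 < bLoop P' ∧ qLoop mL P P' ∈ Set.Ico (0 : ℝ) 1) ∧
        (∀ d : ℕ, ∀ P ∈ goodWith k 0 (d + 1), ∀ P' s, IsDoubleSwitching P P' s →
          P' ∈ goodWith k 0 d ∧ 0 < bDouble P' ∧ qDouble mD P P' ∈ Set.Ico (0 : ℝ) 1) ∧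
        -- accepted switchings preserve uniformity
        (∀ l d : ℕ, (goodWith k (l + 1) d).Nonempty →
          StepMapsUniform mL mD (goodWith k (l + 1) d) (goodWith k l d)) ∧
        (∀ d : ℕ, (goodWith k 0 (d + 1)).Nonempty →
          StepMapsUniform mL mD (goodWith k 0 (d + 1)) (goodWith k 0 d)) ∧
        -- the algorithm terminates with probability one
        (∑' G, outputProb k mL mD G = 1) ∧
        -- its output is exactly uniform over `G(k)`
        (∀ G ∈ graphsWithDegrees k,
          outputProb k mL mD G = ((graphsWithDegrees k).ncard : ℝ≥0∞)⁻¹) ∧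
        (∀ G ∉ graphsWithDegrees k, outputProb k mL mD G = 0) := by
  obtain ⟨M₀, hM₀⟩ := exists_threshold C
  refine ⟨M₀, fun n k hk hC hM' => ?_⟩
  have hM := hM₀ n k hC hM'
  refine ⟨areLowerBounds_explicit hM, ?_, ?_, ?_⟩
  · rintro l d P ⟨hP, rfl, -⟩
    exact ⟨fLoop_le P, fLoop_pos_of_large hM hP⟩
  · rintro d P ⟨hP, -, rfl⟩
    exact ⟨fDouble_le P, fDouble_pos_of_large hM hP⟩
  intro mL mD h
  -- Graphicality provides a simple configuration, on which termination depends.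
  obtain ⟨G, hG⟩ := hk
  obtain ⟨P₀, h1, h2, -⟩ := simpleOver_nonempty hG
  have : Nonempty (Configuration k) := ⟨P₀⟩
  refine ⟨?_, ?_, fun l d => stepMapsUniform_loop hM h, fun d => stepMapsUniform_double hM h,
    tsum_outputProb (P₀ := P₀) (by omega) mL mD, fun G => outputProb_eq_inv hM h,
    fun G => outputProb_eq_zero hM h⟩
  · intro l d P hP Q s hs
    have hQ := (hs.mem_goodWith_iff l d).1 hP
    exact ⟨hQ, bLoop_pos hs, qLoop_mem hM h hP hQ⟩
  · intro d P hP Q s hs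
    have hQ := (hs.mem_goodWith_iff d).1 hP
    exact ⟨hQ, bDouble_pos hs, qDouble_mem hM h hP hQ⟩
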